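/- Let $W$ be a Wiener sheet on $\mathbb R\times[0,\infty)$, i.e. a Gaussian random measure with independent values on disjoint sets and with Lebesgue measure as control measure. Let $\varphi$ be a real Schwartz function on $\mathbb R$ whose Fourier transform $\mathcal F(\varphi)(\lambda)=\int_{\mathbb R}e^{-i\lambda u}\varphi(u)\,du$ is nonzero for almost every $\lambda$. Let $\mu$ be the standard normal distribution on $\mathbb R$. For $\varepsilon>0$ let $$y^\varepsilon(u,t)=u+\sqrt\varepsilon\int_0^t\int_{\mathbb R}\varphi(u-p)\,W(dp,ds),\qquad u\in\mathbb R,\ t\in[0,1],$$ regarded as a random element of $C([0,1];L_2(\mathbb R,\mu))$. Write $e(u)=u$. For $t\in[0,1]$ and $h\in L_2(\mathbb R,\mu)$ put $$I_t(h)=\begin{cases}\dfrac1{4\pi t}\displaystyle\int_{\mathbb R}\left|\frac{\mathcal F(h-e)(\lambda)}{\mathcal F(\varphi)(\lambda)}\right|^2d\lambda,& h\in H_t,\\[2mm] \infty,& h\notin H_t,\end{cases}$$ where $H_t$ is the set of $h\in L_2(\mathbb R,\mu)$ such that $h-e$ is square-integrable with respect to Lebesgue measure and has a (weak) derivative that is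 square-integrable with respect to Lebesgue measure, and $\mathcal F(h-e)$ is the Fourier–Plancherel transform. For $t=0$ the conventions $1/0=\infty$ and $\infty\cdot0=0$ are used, so that $I_0(e)=0$ and $I_0(h)=\infty$ for $h\ne e$. Then for every fixed $t\in[0,1]$ the family $\{y^\varepsilon(\cdot,t)\}_{\varepsilon>0}$ satisfies the large deviation principle in $L_2(\mathbb R,\mu)$ with rate function $I_t$. That is, $I_t:L_2(\mathbb R,\mu)\to[0,\infty]$ is lower semicontinuous, $$\limsup_{\varepsilon\to0+}\varepsilon\log P\{y^\varepsilon(\cdot,t)\in F\}\le-\inf_{f\in F}I_t(f)\quad\text{for every closed }F\subset L_2(\mathbb R,\mu),$$ $$\liminf_{\varepsilon\to0+}\varepsilon\log P\{y^\varepsilon(\cdot,t)\in G\}\ge-\inf_{f\in G}I_t(f)\quad\text{for every open }G\subset L_2(\mathbb R,\mu).$$ -/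

import Mathlib

open MeasureTheory ProbabilityTheory Filter Topology
open scoped ENNReal NNReal SchwartzMap FourierTransform

noncomputable section

namespace FlowLDP

/-- Lebesgue measure on `ℝ × [0, ∞)` (space first, time second), as a measure on `ℝ × ℝ`. -/
def sheetMeasure : Measure (ℝ × ℝ) :=
  (volume : Measure ℝ).prod ((volume : Measure ℝ).restrict (Set.Ici 0))

/-- A Wiener sheet on `ℝ × [0, ∞)`: a Gaussian random measure with independent values on disjoint
sets and with Lebesgue measure as control measure. Only the values `W A` on measurable sets of
finite measure matter. -/
structure IsWienerSheet {Ω : Type*} [MeasurableSpace Ω] (P : Measure Ω)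
    (W : Set (ℝ × ℝ) → Ω → ℝ) : Prop where
  law : ∀ A, MeasurableSet A → sheetMeasure A ≠ ∞ →
    HasLaw (W A) (gaussianReal 0 (sheetMeasure A).toNNReal) P
  indep : ∀ (n : ℕ) (A : Fin n → Set (ℝ × ℝ)),
    (∀ i, MeasurableSet (A i) ∧ sheetMeasure (A i) ≠ ∞) →
    Pairwise (fun i j => Disjoint (A i) (A j)) → iIndepFun (fun i => W (A i)) P
  additive : ∀ A B, MeasurableSet A → sheetMeasure A ≠ ∞ → MeasurableSet B →
    sheetMeasure B ≠ ∞ → Disjoint A B → W (A ∪ B) =ᵐ[P] fun ω => W A ω + W B ω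

/-- The integral `∑ c, c * W (g = c)` of a simple function against the sheet. -/
def simpleSheetIntegral {Ω : Type*} (W : Set (ℝ × ℝ) → Ω → ℝ)
    (g : SimpleFunc (ℝ × ℝ) ℝ) (ω : Ω) : ℝ :=
  ∑ c ∈ g.range.erase 0, c * W (g ⁻¹' {c}) ω

/-- `X` is (a version of) the Wiener integral `∫∫ f(p, s) W(dp, ds)` of the deterministic
square-integrable function `f`: the `L²(P)`-limit of the integrals of simple functions which
converge to `f` in `L²(ℝ × [0, ∞))`. -/
def IsWienerIntegral {Ω : Type*} [MeasurableSpace Ω] (P : Measure Ω)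
    (W : Set (ℝ × ℝ) → Ω → ℝ) (f : ℝ × ℝ → ℝ) (X : Ω → ℝ) : Prop :=
  MemLp f 2 sheetMeasure ∧ AEStronglyMeasurable X P ∧
  ∃ g : ℕ → SimpleFunc (ℝ × ℝ) ℝ,
    (∀ n, MemLp (g n) 2 sheetMeasure) ∧
    Tendsto (fun n => eLpNorm (fun q => f q - g n q) 2 sheetMeasure) atTop (𝓝 0) ∧
    Tendsto (fun n => eLpNorm (fun ω => X ω - simpleSheetIntegral W (g n) ω) 2 P) atTop (𝓝 0)

/-- The space `L₂(ℝ, μ)`, where `μ` is the standard normal distribution. -/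
abbrev L2Gauss : Type := Lp ℝ 2 (gaussianReal 0 1)

/-- The field `y` solves `dy(u, t) = √ε ∫ φ(u - p) W(dp, dt)`, `y(u, 0) = u`, on `[0, 1]`, that is
`y(u, t) = u + √ε ∫_0^t ∫ φ(u - p) W(dp, ds)`, and `Y` is `y` regarded as a random element of
`C([0, 1]; L₂(ℝ, μ))`. -/
structure IsFrozenFlow {Ω : Type*} [MeasurableSpace Ω] (P : Measure Ω)
    (W : Set (ℝ × ℝ) → Ω → ℝ) (φ : 𝓢(ℝ, ℝ)) (ε : ℝ)
    (y : ℝ → unitInterval → Ω → ℝ) (Y : Ω → C(unitInterval, L2Gauss)) : Prop where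
  measurable_field : ∀ t, Measurable fun q : ℝ × Ω => y q.1 t q.2
  solves : ∀ (u : ℝ) (t : unitInterval), ∃ X : Ω → ℝ,
    IsWienerIntegral P W
      (fun q => (Set.Icc (0 : ℝ) t).indicator (fun _ => φ (u - q.1)) q.2) X ∧
    y u t =ᵐ[P] fun ω => u + √ε * X ω
  random_element : AEStronglyMeasurable Y P
  represents : ∀ᵐ ω ∂P, ∀ t, (Y ω t : ℝ → ℝ) =ᵐ[gaussianReal 0 1] fun u => y u t ω

/-- The family `X ε`, `ε → 0+`, satisfies the large deviation principle (with speed `1/ε`) and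
`I` is its (lower semicontinuous) rate function. -/
def SatisfiesLDP {Ω E : Type*} [MeasurableSpace Ω] [TopologicalSpace E] (P : Measure Ω)
    (X : ℝ → Ω → E) (I : E → ℝ≥0∞) : Prop :=
  LowerSemicontinuous I ∧
  (∀ F : Set E, IsClosed F →
    limsup (fun ε : ℝ => (ε : EReal) * ENNReal.log (P {ω | X ε ω ∈ F})) (𝓝[>] 0)
      ≤ -(⨅ f ∈ F, (I f : EReal))) ∧
  (∀ G : Set E, IsOpen G →
    -(⨅ f ∈ G, (I f : EReal)) ≤
      liminf (fun ε : ℝ => (ε : EReal) * ENNReal.log (P {ω | X ε ω ∈ G})) (𝓝[>] 0))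

/-- `g'` is the weak derivative of `g` on `ℝ`. -/
def IsWeakDeriv (g g' : ℝ → ℝ) : Prop :=
  ∀ ψ : ℝ → ℝ, ContDiff ℝ ((⊤ : ℕ∞) : WithTop ℕ∞) ψ → HasCompactSupport ψ →
    ∫ u, g u * deriv ψ u = -∫ u, g' u * ψ u

/-- The Fourier transform `∫ exp(-iξu) φ(u) du` of a real Schwartz function. Mathlib's transform
uses `exp(-2πiξu)`, hence the rescaling. -/
def schwartzFourier (φ : 𝓢(ℝ, ℝ)) (ξ : ℝ) : ℂ :=
  (𝓕 fun u : ℝ => (φ u : ℂ)) (ξ / (2 * Real.pi))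

/-- The Fourier(-Plancherel) transform of a real function from `L₂(ℝ, du)`, in the normalization
`∫ exp(-iξu) g(u) du`; it is determined up to a null set. -/
def l2Fourier (g : ℝ → ℝ) (hg : MemLp g 2 volume) (ξ : ℝ) : ℂ :=
  (𝓕 (hg.ofReal (K := ℂ)).toLp : Lp ℂ 2 (volume : Measure ℝ)) (ξ / (2 * Real.pi))

/-- The centred function `u ↦ h(u) - u`. -/
def centred (h : L2Gauss) (u : ℝ) : ℝ := h u - u

/-- The functions `h ∈ L₂(ℝ, μ)` for which `u ↦ h(u) - u` lies in `L₂(ℝ, du)` and has a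
square-integrable (weak) derivative. -/
def rateDomain : Set L2Gauss :=
  {h | MemLp (centred h) 2 volume ∧
    ∃ g' : ℝ → ℝ, MemLp g' 2 volume ∧ IsWeakDeriv (centred h) g'}

open Classical in
/-- `I_t(h) = (4πt)⁻¹ ∫ |𝓕(h - e)(ξ) / 𝓕(φ)(ξ)|² dξ`, `e(u) = u`, on `rateDomain`, and `∞` outside
of it. For `t = 0` the conventions `0⁻¹ = ∞` and `∞ * 0 = 0` of `[0, ∞]` are in force. -/
def marginalRate (φ : 𝓢(ℝ, ℝ)) (t : unitInterval) (h : L2Gauss) : ℝ≥0∞ :=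
  if hh : h ∈ rateDomain then
    (ENNReal.ofReal (4 * Real.pi * t))⁻¹ *
      ∫⁻ ξ : ℝ, ‖l2Fourier (centred h) hh.1 ξ / schwartzFourier φ ξ‖ₑ ^ 2
  else ∞

end FlowLDP

end

/-! The field minus `e` is a centred Gaussian element of `L₂(ℝ, μ)` whose law at noise level `ε` is
that of `√ε • z` for one fixed Gaussian `z`. Testing against `f` and exchanging the integrals turns
`⟪f, Y t - e⟫` into `√ε` times the Wiener integral of `1_[0,t] ⊗ C† f`, where `C` is convolution
with `φ`. So `z` has covariance `A† A` with `A = √t C†`, and `A† = √t C`.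

For such a law the sublevel set `{I ≤ a}` is `e + A†(ball of radius √(2a))`. By Hahn–Banach and
Riesz (`exists_adjoint_eq_of_inner_le`) it is the intersection of the half-spaces `⟪f, x - e⟫ ≤
√(2a) ‖A f‖`. This gives lower semicontinuity. It also gives the upper bound
(`measure_smul_mem_le`): a compact set missing the sublevel set is covered by finitely many
complementary half-spaces, each of probability at most `exp(-a/ε)`, and exponential tightness, a
consequence of Fernique's theorem, reduces closed sets to compact ones.

For the lower bound, `z` is regressed on `⟪f, z⟫`. The residual is independent of it and, scaled by
`√ε`, is small with probability at least `1/2`, so a one-dimensional estimate settles balls around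
`A† A f` (`le_measure_smul_mem_ball`); such points approximate every `A† g` at almost no extra cost.

Finally (`marginalRate_le_iff`), if `h - e = φ * g`, then the Fourier transform of `φ` being nonzero
a.e. lets division recover `g`, and Plancherel gives `∫ |𝓕(h - e)/𝓕 φ|² = 2π ‖g‖²`. The cost
`‖g‖²/(2t)` is then the stated rate. -/

/-! ### Hilbert space duality for the range of an adjoint. -/

section RangeDuality

open scoped RealInnerProductSpace

variable {H K : Type*} [NormedAddCommGroup H] [InnerProductSpace ℝ H] [CompleteSpace H]
  [NormedAddCommGroup K] [InnerProductSpace ℝ K] [CompleteSpace K]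

/-- The image of a ball under the adjoint of `A` is cut out by the half-spaces containing it. -/
theorem exists_adjoint_eq_of_inner_le (A : H →L[ℝ] K) (h : H) (c : ℝ) (hc : 0 ≤ c)
    (hle : ∀ f, ⟪f, h⟫ ≤ c * ‖A f‖) : ∃ g, ‖g‖ ≤ c ∧ A.adjoint g = h := by
  obtain ⟨s, hs⟩ := LinearMap.exists_rightInverse_of_surjective
    (A : H →ₗ[ℝ] K).rangeRestrict (LinearMap.range_rangeRestrict _)
  have hs' (y : LinearMap.range (A : H →ₗ[ℝ] K)) : A (s y) = y := by
    have := congrArg Subtype.val (LinearMap.congr_fun hs y)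
    simpa using this
  -- The functional `A f ↦ ⟪f, h⟫` on the range of `A`, with `s` a linear choice of preimages. Its
  -- norm-preserving extension to `K` has `g` as Riesz representative.
  let l₀ : LinearMap.range (A : H →ₗ[ℝ] K) →ₗ[ℝ] ℝ := (innerₗ H h) ∘ₗ s
  have hl₀ (y) : ‖l₀ y‖ ≤ c * ‖y‖ := by
    have h1 := hle (s y)
    have h2 := hle (-(s y))
    rw [map_neg, norm_neg, hs', inner_neg_left] at h2
    rw [hs'] at h1
    rw [Real.norm_eq_abs, abs_le]
    simp only [l₀, LinearMap.comp_apply, innerₗ_apply_apply, real_inner_comm (s y) h] at *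
    constructor <;> simp at * <;> linarith
  let l := l₀.mkContinuous c hl₀
  obtain ⟨L, hL, hLn⟩ := exists_extension_norm_eq (LinearMap.range (A : H →ₗ[ℝ] K)) l
  refine ⟨(InnerProductSpace.toDual ℝ K).symm L, ?_, ?_⟩
  · rw [LinearIsometryEquiv.norm_map, hLn]
    exact LinearMap.mkContinuous_norm_le _ hc _
  · refine ext_inner_right ℝ fun f => ?_
    rw [ContinuousLinearMap.adjoint_inner_left, InnerProductSpace.toDual_symm_apply]
    have hf := hL ⟨A f, f, rfl⟩
    simp only at hf
    rw [hf]
    change ⟪h, s ⟨A f, f, rfl⟩⟫ = ⟪h, f⟫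
    -- Applied to both signs of a kernel vector, the bound makes `h` orthogonal to `ker A`, so the
    -- choice of preimage is immaterial.
    have hz : A (s ⟨A f, f, rfl⟩ - f) = 0 := by rw [map_sub, hs', sub_self]
    have h1 := hle (s ⟨A f, f, rfl⟩ - f)
    have h2 := hle (-(s ⟨A f, f, rfl⟩ - f))
    rw [map_neg, hz, inner_neg_left, neg_zero, norm_zero, mul_zero] at h2
    rw [hz, norm_zero, mul_zero] at h1
    have h3 : ⟪s ⟨A f, f, rfl⟩ - f, h⟫ = 0 := by linarith
    rw [inner_sub_left, sub_eq_zero] at h3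
    rw [real_inner_comm, h3, real_inner_comm]

end RangeDuality

/-! ### Logarithmic asymptotics of exponential bounds. -/

section LogAsymptotics

/-- A prefactor `C` independent of `ε` contributes only `ε log C → 0`; every later estimate may
therefore lose a constant. -/
theorem tendsto_mul_log_ofReal_mul_exp (a C : ℝ) (hC : 0 < C) :
    Tendsto (fun ε : ℝ => (ε : EReal) * ENNReal.log (ENNReal.ofReal (C * Real.exp (-a / ε))))
      (𝓝[>] 0) (𝓝 ((-a : ℝ) : EReal)) := by
  have h1 : Tendsto (fun ε : ℝ => ε * Real.log C - a) (𝓝[>] 0) (𝓝 (-a)) := by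
    have : Tendsto (fun ε : ℝ => ε * Real.log C - a) (𝓝 0) (𝓝 (0 * Real.log C - a)) :=
      Continuous.tendsto (by fun_prop) 0
    rw [zero_mul, zero_sub] at this
    exact this.mono_left nhdsWithin_le_nhds
  refine ((continuous_coe_real_ereal.tendsto _).comp h1).congr' ?_
  filter_upwards [self_mem_nhdsWithin] with ε hε
  have hε' : (0 : ℝ) < ε := hε
  have hp : 0 < C * Real.exp (-a / ε) := by positivity
  rw [ENNReal.log_ofReal, if_neg (not_le.2 hp), ← EReal.coe_mul, Function.comp_apply,
    Real.log_mul hC.ne' (Real.exp_ne_zero _), Real.log_exp]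
  congr 1
  field_simp
  ring

theorem limsup_mul_log_le (p : ℝ → ℝ≥0∞) (a C : ℝ) (hC : 0 < C)
    (hp : ∀ᶠ ε in 𝓝[>] (0 : ℝ), p ε ≤ ENNReal.ofReal (C * Real.exp (-a / ε))) :
    limsup (fun ε : ℝ => (ε : EReal) * ENNReal.log (p ε)) (𝓝[>] 0) ≤ ((-a : ℝ) : EReal) := by
  rw [← (tendsto_mul_log_ofReal_mul_exp a C hC).limsup_eq]
  refine limsup_le_limsup ?_
  filter_upwards [hp, self_mem_nhdsWithin] with ε h hε
  exact mul_le_mul_of_nonneg_left (ENNReal.log_le_log h) (EReal.coe_nonneg.2 (le_of_lt hε))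

theorem le_liminf_mul_log (p : ℝ → ℝ≥0∞) (a C : ℝ) (hC : 0 < C)
    (hp : ∀ᶠ ε in 𝓝[>] (0 : ℝ), ENNReal.ofReal (C * Real.exp (-a / ε)) ≤ p ε) :
    ((-a : ℝ) : EReal) ≤ liminf (fun ε : ℝ => (ε : EReal) * ENNReal.log (p ε)) (𝓝[>] 0) := by
  rw [← (tendsto_mul_log_ofReal_mul_exp a C hC).liminf_eq]
  refine liminf_le_liminf ?_
  filter_upwards [hp, self_mem_nhdsWithin] with ε h hε
  exact mul_le_mul_of_nonneg_left (ENNReal.log_le_log h) (EReal.coe_nonneg.2 (le_of_lt hε))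

end LogAsymptotics

/-! ### One-dimensional Gaussian estimates. -/

section OneDimensional

/-- The Chernoff bound for a sub-Gaussian variable. The strict inequality makes the event empty
under the Dirac law of the degenerate case `v = 0`. -/
theorem gaussianReal_setOf_gt_le (v : ℝ≥0) (c ε : ℝ) (hc : 0 ≤ c) (hε : 0 < ε) :
    gaussianReal 0 v {x | c * √v < √ε * x} ≤ ENNReal.ofReal (Real.exp (-(c ^ 2 / 2) / ε)) := by
  rcases eq_or_ne v 0 with rfl | hv
  · rw [gaussianReal_zero_var, Measure.dirac_apply' _ (measurableSet_lt (by fun_prop) (by fun_prop))]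
    simp
  have hv' : (0 : ℝ) < v := by positivity
  have hsub : HasSubgaussianMGF id v (gaussianReal 0 v) :=
    ⟨fun t => by simpa using! integrable_exp_mul_gaussianReal t,
      fun t => by rw [mgf_id_gaussianReal]; simp⟩
  have h := hsub.measure_ge_le (ε := c * √v / √ε) (by positivity)
  calc gaussianReal 0 v {x | c * √v < √ε * x}
      ≤ gaussianReal 0 v {x | c * √v / √ε ≤ id x} := by
        refine measure_mono fun x hx => ?_
        simp only [Set.mem_ofPred_eq, id] at hx ⊢
        rw [div_le_iff₀ (by positivity), mul_comm x]
        exact hx.le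
    _ = ENNReal.ofReal ((gaussianReal 0 v).real {x | c * √v / √ε ≤ id x}) := by
        rw [Measure.real, ENNReal.ofReal_toReal (measure_ne_top _ _)]
    _ ≤ _ := by
        refine ENNReal.ofReal_le_ofReal (h.trans_eq ?_)
        congr 1
        rw [div_pow, mul_pow, Real.sq_sqrt hv'.le, Real.sq_sqrt hε.le]
        field_simp

/-- The density at `v / √ε` is `exp(-v/(2ε))` up to a constant. To the left of that point, as long
as `x ≥ 0`, the density is at least this large, so an interval of length `d / √ε ≥ d` there
suffices. -/
theorem le_gaussianReal_setOf_abs_sub_lt (v : ℝ≥0) (hv : v ≠ 0) (δ : ℝ) (hδ : 0 < δ) :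
    ∃ C, 0 < C ∧ ∀ ε : ℝ, 0 < ε → ε < 1 →
      ENNReal.ofReal (C * Real.exp (-(v / 2) / ε)) ≤ gaussianReal 0 v {x | |√ε * x - v| < δ} := by
  have hv' : (0 : ℝ) < v := by positivity
  -- Capping at `v` keeps the interval in `[0, ∞)`, where the density decreases.
  set d := min δ v with hd
  have hd0 : 0 < d := lt_min hδ hv'
  have hdv : d ≤ v := min_le_right _ _
  refine ⟨(√(2 * Real.pi * v))⁻¹ * d, by positivity, fun ε hε hε1 => ?_⟩
  have hs : 0 < √ε := by positivity
  have hs1 : √ε ≤ 1 := Real.sqrt_le_one.2 hε1.le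
  have hsub : Set.Ioo ((v - d) / √ε) (v / √ε) ⊆ {x | |√ε * x - v| < δ} := by
    intro x hx
    rw [Set.mem_Ioo, div_lt_iff₀ hs, lt_div_iff₀ hs] at hx
    have := min_le_left δ (v : ℝ)
    rw [Set.mem_ofPred_eq, abs_lt]
    constructor <;> nlinarith
  refine le_trans ?_ (measure_mono hsub)
  rw [gaussianReal_apply _ hv]
  calc ENNReal.ofReal ((√(2 * Real.pi * v))⁻¹ * d * Real.exp (-(v / 2) / ε))
      ≤ ENNReal.ofReal (((√(2 * Real.pi * v))⁻¹ * Real.exp (-(v / 2) / ε)) *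
          (v / √ε - (v - d) / √ε)) := by
        refine ENNReal.ofReal_le_ofReal ?_
        have : d ≤ v / √ε - (v - d) / √ε := by
          rw [← sub_div, sub_sub_cancel, le_div_iff₀ hs]
          nlinarith
        calc _ = (√(2 * Real.pi * v))⁻¹ * Real.exp (-(v / 2) / ε) * d := by ring
          _ ≤ _ := by gcongr
    _ = ∫⁻ _ in Set.Ioo ((v - d) / √ε) (v / √ε),
          ENNReal.ofReal ((√(2 * Real.pi * v))⁻¹ * Real.exp (-(v / 2) / ε)) := by
        rw [setLIntegral_const, Real.volume_Ioo, ← ENNReal.ofReal_mul (by positivity)]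
    _ ≤ _ := by
        refine setLIntegral_mono (measurable_gaussianPDF 0 v) fun x hx => ?_
        rw [gaussianPDF]
        refine ENNReal.ofReal_le_ofReal ?_
        rw [gaussianPDFReal_def]
        refine mul_le_mul_of_nonneg_left (Real.exp_le_exp.2 ?_) (by positivity)
        rw [sub_zero]
        have hx0 : 0 ≤ x := le_trans (div_nonneg (by linarith) hs.le) hx.1.le
        have hx2 : x ^ 2 ≤ v ^ 2 / ε := by
          calc x ^ 2 ≤ (v / √ε) ^ 2 := by
                have := hx.2.le
                gcongr
            _ = _ := by rw [div_pow, Real.sq_sqrt hε.le]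
        rw [neg_div, neg_div, neg_le_neg_iff, div_le_iff₀ (by positivity)]
        refine hx2.trans_eq ?_
        field_simp

end OneDimensional

/-! ### Centred Gaussian measures on a Hilbert space and Fernique's bound. -/

section CentredGaussian

set_option linter.unusedSectionVars false

open scoped RealInnerProductSpace

/-- A universal form of Fernique's theorem: the tail of a centred Gaussian measure is controlled by
its second moment. -/
theorem exists_measure_norm_gt_le_of_isGaussian : ∃ α B : ℝ, 0 < α ∧ 0 < B ∧
    ∀ {H : Type*} [NormedAddCommGroup H] [InnerProductSpace ℝ H] [CompleteSpace H]
      [SecondCountableTopology H] [MeasurableSpace H] [BorelSpace H]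
      (ν : Measure H) [IsGaussian ν], ν[id] = 0 → ∀ s : ℝ, 0 < s → ∫ z, ‖z‖ ^ 2 ∂ν ≤ s ^ 2 →
      ∀ t : ℝ, 0 ≤ t → ν {z | t < ‖z‖} ≤ ENNReal.ofReal (B * Real.exp (-(α * (t / s) ^ 2))) := by
  have hc_gt : (2 : ℝ≥0∞)⁻¹ < 3 / 4 := by
    rw [← ENNReal.toReal_lt_toReal (by simp) (by finiteness)]; norm_num
  have hc_lt : (3 / 4 : ℝ≥0∞) < 1 := by
    rw [← ENNReal.toReal_lt_toReal (by finiteness) (by simp)]; norm_num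
  have hα := Fernique.logRatio_pos hc_gt hc_lt
  -- The constant of Fernique's theorem depends on the measure only through the level `3/4`, so it
  -- is uniform over all the measures considered.
  set D : ℝ≥0∞ := .ofReal (Real.exp (Fernique.logRatio (3 / 4)))
        + ∑' n : ℕ, .ofReal (Real.exp (-2⁻¹ * Real.log ((3 / 4 : ℝ≥0∞) / (1 - 3 / 4)).toReal * 2 ^ n))
    with hD
  have hDtop : D ≠ ∞ := by
    refine (ENNReal.add_lt_top.mpr ⟨ENNReal.ofReal_lt_top, ?_⟩).ne
    refine Summable.tsum_ofReal_lt_top <|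
      Real.summable_exp_nat_mul_of_ge ?_ (fun i ↦ mod_cast (Nat.lt_pow_self (by simp)).le)
    refine mul_neg_of_neg_of_pos (by simp) (Real.log_pos ?_)
    rw [ENNReal.toReal_div, ENNReal.toReal_sub_of_le hc_lt.le (by simp)]
    norm_num
  refine ⟨Fernique.logRatio (3 / 4) / 4, D.toReal + 1, by positivity, by positivity, ?_⟩
  intro H _ _ _ _ _ _ ν _ hν s hs hint t ht
  have hsq : Integrable (fun z : H => ‖z‖ ^ 2) ν :=
    (IsGaussian.memLp_two_id (μ := ν)).integrable_norm_pow (by simp)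
  -- Markov's inequality for `‖z‖²` at radius `2 * s` leaves mass at most `1/4` outside the ball.
  have hc : 3 / 4 ≤ ν {z | ‖z‖ ≤ 2 * s} := by
    have hmark : ν {z | 2 * s < ‖z‖} ≤ 1 / 4 := by
      calc ν {z | 2 * s < ‖z‖}
          ≤ ν {z | ENNReal.ofReal ((2 * s) ^ 2) ≤ ENNReal.ofReal (‖z‖ ^ 2)} := by
            refine measure_mono fun z hz => ?_
            simp only [Set.mem_ofPred_eq] at hz ⊢
            gcongr
        _ ≤ (∫⁻ z, ENNReal.ofReal (‖z‖ ^ 2) ∂ν) / ENNReal.ofReal ((2 * s) ^ 2) :=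
            meas_ge_le_lintegral_div (by fun_prop)
              (by rw [Ne, ENNReal.ofReal_eq_zero, not_le]; positivity) (by simp)
        _ ≤ ENNReal.ofReal (s ^ 2) / ENNReal.ofReal ((2 * s) ^ 2) := by
            rw [← ofReal_integral_eq_lintegral_ofReal hsq (ae_of_all _ fun _ => by positivity)]
            gcongr
        _ = 1 / 4 := by
            rw [← ENNReal.ofReal_div_of_pos (by positivity)]
            have : s ^ 2 / (2 * s) ^ 2 = 1 / 4 := by field_simp; norm_num
            rw [this, ENNReal.ofReal_div_of_pos (by norm_num)]; simp
    have hcompl : {z : H | ‖z‖ ≤ 2 * s} = {z | 2 * s < ‖z‖}ᶜ := by ext; simp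
    rw [hcompl, prob_compl_eq_one_sub (measurableSet_lt (by fun_prop) (by fun_prop))]
    calc (3 / 4 : ℝ≥0∞) = 1 - 1 / 4 := by
          rw [← ENNReal.toReal_eq_toReal_iff' (by finiteness) (by finiteness),
            ENNReal.toReal_sub_of_le _ (by simp)]
          · norm_num
          · rw [← ENNReal.toReal_le_toReal (by finiteness) (by simp)]; norm_num
      _ ≤ _ := by gcongr
  have hF := lintegral_exp_mul_sq_norm_le_of_map_rotation_eq_self
    (IsGaussian.map_rotation_eq_self hν _) hc hc_gt
  rw [← hD] at hF
  set β := Fernique.logRatio (3 / 4) * (2 * s)⁻¹ ^ 2 with hβ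
  have hβ0 : 0 < β := by positivity
  calc ν {z | t < ‖z‖}
      ≤ ν {z | ENNReal.ofReal (Real.exp (β * t ^ 2)) ≤ ENNReal.ofReal (Real.exp (β * ‖z‖ ^ 2))} := by
        refine measure_mono fun z hz => ?_
        simp only [Set.mem_ofPred_eq] at hz ⊢
        gcongr
    _ ≤ (∫⁻ z, ENNReal.ofReal (Real.exp (β * ‖z‖ ^ 2)) ∂ν) / ENNReal.ofReal (Real.exp (β * t ^ 2)) :=
        meas_ge_le_lintegral_div (by fun_prop)
          (by rw [Ne, ENNReal.ofReal_eq_zero, not_le]; positivity) (by simp)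
    _ ≤ ENNReal.ofReal (D.toReal + 1) / ENNReal.ofReal (Real.exp (β * t ^ 2)) := by
        gcongr
        refine hF.trans ?_
        rw [ENNReal.ofReal_add (by positivity) (by simp), ENNReal.ofReal_toReal hDtop]
        exact le_self_add
    _ = _ := by
        have hexp : β * t ^ 2 = Fernique.logRatio (3 / 4) / 4 * (t / s) ^ 2 := by
          rw [hβ]; field_simp; ring
        rw [← ENNReal.ofReal_div_of_pos (by positivity), Real.exp_neg, hexp, div_eq_mul_inv]

variable {H K : Type*} [NormedAddCommGroup H] [InnerProductSpace ℝ H] [CompleteSpace H]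
  [SecondCountableTopology H] [MeasurableSpace H] [BorelSpace H]
  [NormedAddCommGroup K] [InnerProductSpace ℝ K] [CompleteSpace K]

/-- The law `ν` is the centred Gaussian measure with covariance operator `A† A`. -/
structure IsCentredGaussian (ν : Measure H) (A : H →L[ℝ] K) : Prop where
  isProbabilityMeasure : IsProbabilityMeasure ν
  map_inner : ∀ f, ν.map (fun z => ⟪f, z⟫) = gaussianReal 0 (‖A f‖₊ ^ 2)

namespace IsCentredGaussian

variable {ν : Measure H} {A : H →L[ℝ] K}

theorem isGaussian (h : IsCentredGaussian ν A) : IsGaussian ν := by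
  refine isGaussian_of_map_eq_gaussianReal fun L =>
    ⟨0, ‖A ((InnerProductSpace.toDual ℝ H).symm L)‖₊ ^ 2, ?_⟩
  rw [← h.map_inner]
  congr 1
  ext z
  rw [InnerProductSpace.toDual_symm_apply]

theorem integral_id (h : IsCentredGaussian ν A) : ν[id] = 0 := by
  have := h.isGaussian
  refine ext_inner_left ℝ fun f => ?_
  rw [← integral_inner (IsGaussian.integrable_id), inner_zero_right]
  have := integral_map (μ := ν) (φ := fun z => ⟪f, z⟫) (f := fun x : ℝ => x) (by fun_prop)
    (by fun_prop)
  rw [h.map_inner, integral_id_gaussianReal] at this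
  simpa using this.symm

theorem variance_inner (h : IsCentredGaussian ν A) (f : H) :
    Var[fun z => ⟪f, z⟫; ν] = ‖A f‖ ^ 2 := by
  have := variance_map (μ := ν) (X := fun x : ℝ => x) (Y := fun z => ⟪f, z⟫) (by fun_prop)
    (by fun_prop)
  rw [h.map_inner, variance_fun_id_gaussianReal] at this
  rw [show (fun z => ⟪f, z⟫) = (fun x : ℝ => x) ∘ (fun z => ⟪f, z⟫) from rfl, ← this]
  simp

theorem memLp_inner (h : IsCentredGaussian ν A) (f : H) : MemLp (fun z => ⟪f, z⟫) 2 ν := by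
  have := h.isGaussian
  exact (innerSL ℝ f).comp_memLp' (IsGaussian.memLp_two_id (μ := ν))

/-- Polarization of the variance identity. -/
theorem covariance_inner (h : IsCentredGaussian ν A) (f g : H) :
    cov[fun z => ⟪f, z⟫, fun z => ⟪g, z⟫; ν] = ⟪A f, A g⟫ := by
  have := h.isProbabilityMeasure
  have h1 := h.variance_inner (f + g)
  simp_rw [inner_add_left] at h1
  rw [variance_fun_add (h.memLp_inner f) (h.memLp_inner g), h.variance_inner, h.variance_inner,
    map_add, norm_add_sq_real] at h1
  linarith

end IsCentredGaussian

end CentredGaussian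

/-! ### Finite-dimensional approximation and compactness. -/

section FiniteDimensionalApproximation

set_option linter.unusedSectionVars false

variable (H : Type*) [NormedAddCommGroup H] [InnerProductSpace ℝ H] [CompleteSpace H]
  [SecondCountableTopology H]

/-- The span of the first `n` terms of a dense sequence. -/
def denseSpan (n : ℕ) : Submodule ℝ H :=
  Submodule.span ℝ (TopologicalSpace.denseSeq H '' Set.Iio n)

instance (n : ℕ) : FiniteDimensional ℝ (denseSpan H n) :=
  FiniteDimensional.span_of_finite ℝ ((Set.finite_Iio n).image _)

/-- The projection onto the orthogonal complement of `denseSpan H n`. -/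
noncomputable def denseSpanResidual (n : ℕ) : H →L[ℝ] H :=
  ContinuousLinearMap.id ℝ H - (denseSpan H n).starProjection

variable {H}

theorem norm_denseSpanResidual_le_of_mem (n : ℕ) (z x : H) (hx : x ∈ denseSpan H n) :
    ‖denseSpanResidual H n z‖ ≤ ‖z - x‖ := by
  have h := Submodule.starProjection_minimal (U := denseSpan H n) z
  have hb : BddBelow (Set.range fun x : denseSpan H n => ‖z - x‖) :=
    ⟨0, by rintro _ ⟨x, rfl⟩; positivity⟩
  exact h.le.trans (ciInf_le hb ⟨x, hx⟩)

theorem norm_denseSpanResidual_le (n : ℕ) (z : H) : ‖denseSpanResidual H n z‖ ≤ ‖z‖ := by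
  simpa using norm_denseSpanResidual_le_of_mem n z 0 (zero_mem _)

theorem tendsto_norm_denseSpanResidual (z : H) :
    Tendsto (fun n => ‖denseSpanResidual H n z‖) atTop (𝓝 0) := by
  rw [Metric.tendsto_atTop]
  intro δ hδ
  obtain ⟨N, hN⟩ := (TopologicalSpace.denseRange_denseSeq H).exists_dist_lt z hδ
  refine ⟨N + 1, fun n hn => ?_⟩
  rw [dist_zero_right, norm_norm]
  refine (norm_denseSpanResidual_le_of_mem n z _ (Submodule.subset_span ⟨N, ?_, rfl⟩)).trans_lt ?_
  · exact hn
  · rwa [← dist_eq_norm]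

/-- A bounded closed set which is uniformly approximated by finite-dimensional subspaces is
compact. -/
theorem isCompact_of_norm_denseSpanResidual_le (ρ : ℝ) (n : ℕ → ℕ) (r : ℕ → ℝ)
    (hr : Tendsto r atTop (𝓝 0)) :
    IsCompact {z : H | ‖z‖ ≤ ρ ∧ ∀ k, ‖denseSpanResidual H (n k) z‖ ≤ r k} := by
  refine TotallyBounded.isCompact_of_isClosed ?_ ?_
  · rw [Metric.totallyBounded_iff]
    intro δ hδ
    obtain ⟨k, hk⟩ := (hr.eventually (gt_mem_nhds (half_pos hδ))).exists
    have hK : IsCompact (((↑) : denseSpan H (n k) → H) '' Metric.closedBall 0 ρ) :=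
      (isCompact_closedBall _ _).image continuous_subtype_val
    obtain ⟨t, ht, hcov⟩ := Metric.totallyBounded_iff.1 hK.totallyBounded (δ / 2) (half_pos hδ)
    refine ⟨t, ht, fun z hz => ?_⟩
    have hmem : (denseSpan H (n k)).starProjection z ∈
        ((↑) : denseSpan H (n k) → H) '' Metric.closedBall 0 ρ := by
      refine ⟨⟨_, Submodule.starProjection_apply_mem _ z⟩, ?_, rfl⟩
      rw [mem_closedBall_zero_iff]
      exact (Submodule.norm_starProjection_apply_le _ z).trans hz.1
    have := hcov hmem
    simp only [Set.mem_iUnion, Metric.mem_ball] at this ⊢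
    obtain ⟨y, hy, hd⟩ := this
    refine ⟨y, hy, ?_⟩
    have h1 : dist z ((denseSpan H (n k)).starProjection z) ≤ r k := by
      rw [dist_eq_norm]; exact hz.2 k
    linarith [dist_triangle z ((denseSpan H (n k)).starProjection z) y]
  · simp only [Set.ofPred_and, Set.ofPred_forall]
    exact (isClosed_le (by fun_prop) (by fun_prop)).inter
      (isClosed_iInter fun k => isClosed_le (by fun_prop) (by fun_prop))

end FiniteDimensionalApproximation

/-! ### Exponential tightness and the upper bound. -/

namespace IsCentredGaussian

open scoped RealInnerProductSpace

variable {H K : Type*} [NormedAddCommGroup H] [InnerProductSpace ℝ H] [CompleteSpace H]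
  [SecondCountableTopology H] [MeasurableSpace H] [BorelSpace H]
  [NormedAddCommGroup K] [InnerProductSpace ℝ K] [CompleteSpace K]
  {ν : Measure H} {A : H →L[ℝ] K}

theorem exists_integral_sq_denseSpanResidual_le (h : IsCentredGaussian ν A) (c : ℝ) (hc : 0 < c) :
    ∃ n, ∫ z, ‖denseSpanResidual H n z‖ ^ 2 ∂ν ≤ c := by
  have := h.isGaussian
  have hlim : Tendsto (fun n => ∫ z, ‖denseSpanResidual H n z‖ ^ 2 ∂ν) atTop
      (𝓝 (∫ _, (0 : ℝ) ∂ν)) := by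
    refine tendsto_integral_of_dominated_convergence (fun z => ‖z‖ ^ 2) (fun n => by fun_prop)
      ((IsGaussian.memLp_two_id (μ := ν)).integrable_norm_pow (by simp))
      (fun n => ae_of_all _ fun z => ?_) (ae_of_all _ fun z => ?_)
    · rw [Real.norm_eq_abs, abs_of_nonneg (by positivity)]
      gcongr
      exact norm_denseSpanResidual_le n z
    · simpa using (tendsto_norm_denseSpanResidual z).pow 2
  rw [integral_zero] at hlim
  obtain ⟨n, hn⟩ := (hlim.eventually (gt_mem_nhds hc)).exists
  exact ⟨n, hn.le⟩

/-- Fernique's bound applied to the Gaussian image measure under `R`. The constants precede all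
other quantifiers, so they serve every residual projection at once. -/
theorem exists_measure_clm_norm_gt_le : ∃ α B : ℝ, 0 < α ∧ 0 < B ∧
    ∀ {H K : Type*} [NormedAddCommGroup H] [InnerProductSpace ℝ H] [CompleteSpace H]
      [SecondCountableTopology H] [MeasurableSpace H] [BorelSpace H]
      [NormedAddCommGroup K] [InnerProductSpace ℝ K] [CompleteSpace K]
      {ν : Measure H} {A : H →L[ℝ] K}, IsCentredGaussian ν A → ∀ (R : H →L[ℝ] H) (s : ℝ), 0 < s →
      ∫ z, ‖R z‖ ^ 2 ∂ν ≤ s ^ 2 → ∀ t : ℝ, 0 ≤ t →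
      ν {z | t < ‖R z‖} ≤ ENNReal.ofReal (B * Real.exp (-(α * (t / s) ^ 2))) := by
  obtain ⟨α, B, hα, hB, hF⟩ := exists_measure_norm_gt_le_of_isGaussian
  refine ⟨α, B, hα, hB, ?_⟩
  intro H K _ _ _ _ _ _ _ _ _ ν A h R s hs hint t ht
  have := h.isGaussian
  have h1 : (ν.map R)[id] = 0 := by
    rw [integral_map (by fun_prop) (by fun_prop)]
    have hR := R.integral_comp_comm (IsGaussian.integrable_id (μ := ν))
    rw [h.integral_id, map_zero] at hR
    exact hR
  have h2 : ∫ z, ‖z‖ ^ 2 ∂(ν.map R) ≤ s ^ 2 := by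
    rwa [integral_map (by fun_prop) (by fun_prop)]
  have := hF (ν.map R) h1 s hs h2 t ht
  rwa [Measure.map_apply (by fun_prop) (measurableSet_lt (by fun_prop) (by fun_prop))] at this

/-- Exponential tightness of the rescaled Gaussian measures. -/
theorem exponentiallyTight (h : IsCentredGaussian ν A) (a : ℝ) :
    ∃ S : Set H, IsCompact S ∧ ∃ C, 0 < C ∧ ∀ᶠ ε in 𝓝[>] (0 : ℝ),
      ν {z | √ε • z ∉ S} ≤ ENNReal.ofReal (C * Real.exp (-a / ε)) := by
  obtain ⟨α, B, hα, hB, hF⟩ := exists_measure_clm_norm_gt_le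
  have hG := h.isGaussian
  -- The `k`-th residual has root mean square at most `4⁻ᵏ` but is allowed size `ρ 2⁻ᵏ`. The ratio
  -- `ρ 2ᵏ` makes its tail at most `B q ^ (k + 1)`, where `q = exp(-b/ε)`, which is summable in `k`.
  choose n hn using fun k : ℕ => h.exists_integral_sq_denseSpanResidual_le (((1 / 4 : ℝ) ^ k) ^ 2)
    (by positivity)
  obtain ⟨c₀, hc₀, hc₀'⟩ : ∃ c₀ : ℝ, 0 < c₀ ∧ ∫ z, ‖z‖ ^ 2 ∂ν ≤ c₀ ^ 2 := by
    have h0 : 0 ≤ ∫ z, ‖z‖ ^ 2 ∂ν := integral_nonneg fun z => by positivity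
    refine ⟨1 + ∫ z, ‖z‖ ^ 2 ∂ν, by positivity, by nlinarith⟩
  -- With `b ≥ 1` and `ε < 1`, `q = exp(-b/ε)` is at most `1/2`, so the geometric series at most
  -- doubles its first term.
  set b := max a 1
  have hb : 0 < b := by positivity
  set ρ := √(b / α)
  have hρ : ρ ^ 2 = b / α := Real.sq_sqrt (by positivity)
  refine ⟨_, isCompact_of_norm_denseSpanResidual_le (ρ * c₀) n (fun k => ρ * (1 / 2) ^ k) ?_,
    3 * B, by positivity, ?_⟩
  · simpa using (tendsto_pow_atTop_nhds_zero_of_lt_one (by norm_num : (0 : ℝ) ≤ 1 / 2)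
      (by norm_num)).const_mul ρ
  have hev : ∀ᶠ ε in 𝓝[>] (0 : ℝ), ε < 1 := nhdsWithin_le_nhds (gt_mem_nhds one_pos)
  filter_upwards [self_mem_nhdsWithin, hev] with ε hε hε1
  replace hε : 0 < ε := hε
  have hs : 0 < √ε := by positivity
  set q := Real.exp (-b / ε) with hq
  have hq0 : 0 < q := Real.exp_pos _
  have hq2 : q ≤ 1 / 2 := by
    have : Real.exp (-b / ε) ≤ Real.exp (-1) := by
      rw [Real.exp_le_exp, div_le_iff₀ hε]
      have : 1 ≤ b := le_max_right _ _
      linarith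
    refine this.trans ?_
    rw [Real.exp_neg, one_div]
    gcongr
    linarith [Real.add_one_le_exp (1 : ℝ)]
  have hbound (R : H →L[ℝ] H) (s t : ℝ) (hs' : 0 < s) (ht : 0 ≤ t)
      (hR : ∫ z, ‖R z‖ ^ 2 ∂ν ≤ s ^ 2) (m : ℕ) (hm : m * b ≤ α * (t / s) ^ 2) :
      ν {z | t < ‖R (√ε • z)‖} ≤ ENNReal.ofReal (B * q ^ m) := by
    calc ν {z | t < ‖R (√ε • z)‖} ≤ ν {z | t / √ε < ‖R z‖} := by
          refine measure_mono fun z hz => ?_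
          rw [Set.mem_ofPred_eq, map_smul, norm_smul, Real.norm_of_nonneg hs.le] at hz
          rwa [Set.mem_ofPred_eq, div_lt_iff₀' hs]
      _ ≤ _ := hF h R s hs' hR _ (by positivity)
      _ ≤ _ := by
          rw [hq, ← Real.exp_nat_mul]
          gcongr
          rw [mul_div_assoc', le_div_iff₀ hε]
          have : (t / √ε / s) ^ 2 * ε = (t / s) ^ 2 := by
            rw [div_right_comm, div_pow _ (√ε), Real.sq_sqrt hε.le]
            field_simp
          nlinarith
  calc ν _ ≤ ν ({z | ρ * c₀ < ‖ContinuousLinearMap.id ℝ H (√ε • z)‖} ∪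
        ⋃ k, {z | ρ * (1 / 2) ^ k < ‖denseSpanResidual H (n k) (√ε • z)‖}) := by
        refine measure_mono fun z hz => ?_
        by_contra hcon
        simp only [Set.mem_union, Set.mem_iUnion, Set.mem_ofPred_eq, not_or, not_exists,
          not_lt] at hcon hz
        exact hz ⟨by simpa using hcon.1, hcon.2⟩
    _ ≤ ENNReal.ofReal (B * q ^ 1) + ∑' k : ℕ, ENNReal.ofReal (B * q ^ (k + 1)) := by
        refine (measure_union_le _ _).trans (add_le_add ?_ ((measure_iUnion_le _).trans ?_))
        · refine hbound _ c₀ _ hc₀ (by positivity) (by simpa using hc₀') 1 ?_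
          rw [mul_div_assoc, div_self hc₀.ne', mul_one, hρ]
          apply le_of_eq
          field_simp
          simp
        · refine ENNReal.tsum_le_tsum fun k => ?_
          refine hbound _ ((1 / 4) ^ k) _ (by positivity) (by positivity) (hn k) (k + 1) ?_
          have h1 : (ρ * (1 / 2) ^ k / (1 / 4) ^ k) ^ 2 = b / α * 4 ^ k := by
            rw [mul_div_assoc, ← div_pow, mul_pow, hρ, ← pow_mul, mul_comm k, pow_mul]
            norm_num
          rw [h1]
          have h2 : ((k + 1 : ℕ) : ℝ) ≤ 4 ^ k := by
            have : k + 1 ≤ 4 ^ k := Nat.lt_pow_self (by norm_num)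
            exact_mod_cast this
          calc ((k + 1 : ℕ) : ℝ) * b ≤ 4 ^ k * b := by gcongr
            _ = _ := by field_simp
    _ ≤ ENNReal.ofReal (B * q) + ENNReal.ofReal (2 * B * q) := by
        rw [pow_one]
        gcongr
        have hsum := (hasSum_geometric_of_lt_one hq0.le (by linarith : q < 1)).mul_left (B * q)
        have heq : (fun k : ℕ => B * q * q ^ k) = fun k => B * q ^ (k + 1) := by
          ext k; ring
        rw [heq] at hsum
        rw [← ENNReal.ofReal_tsum_of_nonneg (fun k => by positivity) hsum.summable, hsum.tsum_eq]
        refine ENNReal.ofReal_le_ofReal ?_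
        rw [mul_inv_le_iff₀ (by linarith)]
        nlinarith [mul_pos hB hq0]
    _ ≤ _ := by
        rw [← ENNReal.ofReal_add (by positivity) (by positivity)]
        refine ENNReal.ofReal_le_ofReal ?_
        have : q ≤ Real.exp (-a / ε) := by
          rw [hq, Real.exp_le_exp]
          have : a ≤ b := le_max_left _ _
          gcongr
        nlinarith

/-- The large deviation upper bound for closed sets. -/
theorem measure_smul_mem_le (h : IsCentredGaussian ν A) (F : Set H) (hF : IsClosed F) (a : ℝ)
    (ha : 0 ≤ a) (hdisj : ∀ g, ‖g‖ ^ 2 ≤ 2 * a → A.adjoint g ∉ F) :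
    ∃ C, 0 < C ∧ ∀ᶠ ε in 𝓝[>] (0 : ℝ),
      ν {z | √ε • z ∈ F} ≤ ENNReal.ofReal (C * Real.exp (-a / ε)) := by
  obtain ⟨S, hS, C, hC, hSC⟩ := h.exponentiallyTight a
  set c := √(2 * a) with hc
  have hcs : c ^ 2 = 2 * a := Real.sq_sqrt (by positivity)
  -- If no half-space separated `x` from the image of the ball, duality would put `x` in that image,
  -- which avoids `F`.
  have hex (x : H) (hx : x ∈ S ∩ F) : ∃ f, c * ‖A f‖ < ⟪f, x⟫ := by
    by_contra! hcon
    obtain ⟨g, hg, hgx⟩ := exists_adjoint_eq_of_inner_le A x c (by positivity) hcon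
    refine hdisj g ?_ (hgx ▸ hx.2)
    rw [← hcs]
    gcongr
  choose! f hf using hex
  obtain ⟨t, ht, hcov⟩ := (hS.inter_right hF).elim_nhds_subcover
    (fun x => {y | c * ‖A (f x)‖ < ⟪f x, y⟫}) fun x hx =>
      (isOpen_lt (by fun_prop) (by fun_prop)).mem_nhds (hf x hx)
  refine ⟨C + t.card, by positivity, ?_⟩
  filter_upwards [hSC, self_mem_nhdsWithin] with ε hε1 hε
  replace hε : 0 < ε := hε
  have hhalf (g : H) : ν {z | c * ‖A g‖ < ⟪g, √ε • z⟫} ≤ ENNReal.ofReal (Real.exp (-a / ε)) := by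
    have h1 := gaussianReal_setOf_gt_le (‖A g‖₊ ^ 2) c ε (by positivity) hε
    rw [← h.map_inner, Measure.map_apply (by fun_prop)
      (measurableSet_lt (by fun_prop) (by fun_prop)), hcs] at h1
    have h2 : √((‖A g‖₊ ^ 2 : ℝ≥0) : ℝ) = ‖A g‖ := by
      rw [NNReal.coe_pow, coe_nnnorm, Real.sqrt_sq (norm_nonneg _)]
    rw [h2, mul_div_cancel_left₀ a two_ne_zero] at h1
    simpa [inner_smul_right] using! h1
  calc ν {z | √ε • z ∈ F}
      ≤ ν ({z | √ε • z ∉ S} ∪ ⋃ x ∈ t, {z | c * ‖A (f x)‖ < ⟪f x, √ε • z⟫}) := by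
        refine measure_mono fun z hz => ?_
        by_cases hzS : √ε • z ∈ S
        · have := hcov ⟨hzS, hz⟩
          simp only [Set.mem_iUnion] at this
          exact Or.inr (by simpa using this)
        · exact Or.inl hzS
    _ ≤ ENNReal.ofReal (C * Real.exp (-a / ε)) + ∑ _ ∈ t, ENNReal.ofReal (Real.exp (-a / ε)) :=
        (measure_union_le _ _).trans (add_le_add hε1
          ((measure_biUnion_finset_le _ _).trans (Finset.sum_le_sum fun x _ => hhalf _)))
    _ = _ := by
        rw [Finset.sum_const, nsmul_eq_mul, ← ENNReal.ofReal_natCast,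
          ← ENNReal.ofReal_mul (by positivity), ← ENNReal.ofReal_add (by positivity) (by positivity),
          add_mul]

end IsCentredGaussian

/-! ### The lower bound and the abstract large deviation principle. -/

/-- Vectors in the range of `A` approximate every `g` modulo the kernel of the adjoint. -/
theorem ContinuousLinearMap.exists_adjoint_apply_near {H K : Type*}
    [NormedAddCommGroup H] [InnerProductSpace ℝ H] [CompleteSpace H]
    [NormedAddCommGroup K] [InnerProductSpace ℝ K] [CompleteSpace K] (A : H →L[ℝ] K) (g : K) (r : ℝ)
    (hr : 0 < r) :
    ∃ f, ‖A f‖ < ‖g‖ + r ∧ dist (A.adjoint (A f)) (A.adjoint g) < r := by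
  -- The orthogonal complement of `V` is `ker A†`, so projecting `g` to `V` keeps `A† g` and does
  -- not increase the norm.
  let V := (LinearMap.range (A : H →ₗ[ℝ] K)).topologicalClosure
  have hVc : CompleteSpace V := (Submodule.isClosed_topologicalClosure _).completeSpace_coe
  let g' := V.starProjection g
  have hg' : g' ∈ V := Submodule.starProjection_apply_mem _ _
  have hker : A.adjoint g' = A.adjoint g := by
    refine ext_inner_right ℝ fun y => ?_
    rw [ContinuousLinearMap.adjoint_inner_left, ContinuousLinearMap.adjoint_inner_left,
      ← sub_eq_zero, ← inner_sub_left, ← neg_sub, inner_neg_left, neg_eq_zero]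
    exact Submodule.inner_left_of_mem_orthogonal
      (Submodule.le_topologicalClosure _ ⟨y, rfl⟩ : A y ∈ V)
      (Submodule.sub_starProjection_mem_orthogonal (K := V) g)
  have hnorm : ‖g'‖ ≤ ‖g‖ := Submodule.norm_starProjection_apply_le _ _
  have hU : {k : K | ‖k‖ < ‖g‖ + r ∧ dist (A.adjoint k) (A.adjoint g) < r} ∈ 𝓝 g' := by
    refine IsOpen.mem_nhds ?_ ⟨by linarith, by simpa [hker] using hr⟩
    rw [Set.ofPred_and]
    exact (isOpen_lt (by fun_prop) (by fun_prop)).inter (isOpen_lt (by fun_prop) (by fun_prop))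
  obtain ⟨k, hk, ⟨f, rfl⟩⟩ := mem_closure_iff_nhds.1
    (show g' ∈ closure ((LinearMap.range (A : H →ₗ[ℝ] K) : Submodule ℝ K) : Set K) from hg') _ hU
  exact ⟨f, hk⟩

namespace IsCentredGaussian

open scoped RealInnerProductSpace

variable {H K : Type*} [NormedAddCommGroup H] [InnerProductSpace ℝ H] [CompleteSpace H]
  [SecondCountableTopology H] [MeasurableSpace H] [BorelSpace H]
  [NormedAddCommGroup K] [InnerProductSpace ℝ K] [CompleteSpace K]
  {ν : Measure H} {A : H →L[ℝ] K}

/-- Small balls have large probability for small noise. -/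
theorem eventually_half_le_measure {E : Type*} [NormedAddCommGroup E] [NormedSpace ℝ E]
    [MeasurableSpace E] [BorelSpace E] (ν : Measure E) [IsProbabilityMeasure ν] (r : ℝ)
    (hr : 0 < r) :
    ∀ᶠ ε in 𝓝[>] (0 : ℝ), 1 / 2 ≤ ν {z | ‖√ε • z‖ < r} := by
  have hev : ∀ᶠ n : ℕ in atTop, (1 / 2 : ℝ≥0∞) < ν {z | ‖z‖ < n} := by
    have hmono : Monotone fun n : ℕ => {z : E | ‖z‖ < n} := fun m n hmn z hz =>
      lt_of_lt_of_le (show ‖z‖ < m from hz) (by exact_mod_cast hmn)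
    have hlim := tendsto_measure_iUnion_atTop (μ := ν) hmono
    have huniv : ⋃ n : ℕ, {z : E | ‖z‖ < n} = Set.univ := by
      ext z
      simpa using! exists_nat_gt ‖z‖
    rw [huniv, measure_univ] at hlim
    exact hlim.eventually (lt_mem_nhds (by simp))
  obtain ⟨n, hn, hn0⟩ := (hev.and (eventually_gt_atTop 0)).exists
  have hn0' : (0 : ℝ) < n := by exact_mod_cast hn0
  have hsm : ∀ᶠ ε in 𝓝[>] (0 : ℝ), √ε < r / n := by
    have : Tendsto (fun ε : ℝ => √ε) (𝓝[>] 0) (𝓝 0) := by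
      simpa using (Real.continuous_sqrt.tendsto 0).mono_left nhdsWithin_le_nhds
    exact this.eventually (gt_mem_nhds (by positivity))
  filter_upwards [hsm] with ε hε
  refine hn.le.trans (measure_mono fun z hz => ?_)
  rw [Set.mem_ofPred_eq, norm_smul, Real.norm_of_nonneg (Real.sqrt_nonneg _)]
  rw [lt_div_iff₀ hn0'] at hε
  have hz' : ‖z‖ ≤ n := le_of_lt hz
  calc √ε * ‖z‖ ≤ √ε * n := by gcongr
    _ < r := hε

/-- The large deviation lower bound for balls centred in the range of the covariance. -/
theorem le_measure_smul_mem_ball (h : IsCentredGaussian ν A) (f : H) (r : ℝ) (hr : 0 < r) :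
    ∃ C, 0 < C ∧ ∀ᶠ ε in 𝓝[>] (0 : ℝ),
      ENNReal.ofReal (C * Real.exp (-(‖A f‖ ^ 2 / 2) / ε)) ≤
        ν {z | √ε • z ∈ Metric.ball (A.adjoint (A f)) r} := by
  have hP := h.isProbabilityMeasure
  have hG := h.isGaussian
  have hhalf : (1 / 2 : ℝ≥0∞) = ENNReal.ofReal (1 / 2) := by
    rw [ENNReal.ofReal_div_of_pos (by norm_num)]; simp
  by_cases hf : A f = 0
  · refine ⟨1 / 2, by norm_num, ?_⟩
    filter_upwards [eventually_half_le_measure ν r hr] with ε hε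
    simpa [hf, mem_ball_zero_iff, hhalf] using! hε
  set x := A.adjoint (A f) with hx
  set s := ‖A f‖ ^ 2 with hs
  have hs0 : 0 < s := by positivity
  -- The regression residual: `x` is the covariance of `z` with `⟪f, z⟫`, and `s` is the variance of
  -- `⟪f, z⟫`. Uncorrelated and jointly Gaussian, `Z` and `⟪f, z⟫` are independent.
  set Z : H → H := fun z => z - (s⁻¹ * ⟪f, z⟫) • x with hZ
  have hZc : Measurable Z := by fun_prop
  have hind : (fun z : H => ⟪f, z⟫) ⟂ᵢ[ν] Z := by
    refine HasGaussianLaw.indepFun_of_covariance_inner ⟨?_⟩ fun a y => ?_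
    · let L : H →L[ℝ] ℝ × H := (innerSL ℝ f).prod
        (ContinuousLinearMap.id ℝ H - (s⁻¹ • innerSL ℝ f).smulRight x)
      exact isGaussian_map L
    · have h1 : (fun z => inner ℝ a ⟪f, z⟫) = fun z => a * ⟪f, z⟫ := by
        ext z; simp [mul_comm]
      have h2 : (fun z => ⟪y, Z z⟫) = fun z => ⟪y, z⟫ - (s⁻¹ * ⟪y, x⟫) * ⟪f, z⟫ := by
        ext z; simp only [hZ, inner_sub_right, inner_smul_right]; ring
      have h3 : ⟪y, x⟫ = ⟪A y, A f⟫ := by rw [hx, ContinuousLinearMap.adjoint_inner_right]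
      rw [h1, h2, covariance_const_mul_left,
        covariance_fun_sub_right (h.memLp_inner f) (h.memLp_inner y)
          ((h.memLp_inner f).const_mul _), covariance_const_mul_right, h.covariance_inner,
        h.covariance_inner, real_inner_self_eq_norm_sq, ← hs, h3, real_inner_comm]
      field_simp
      simp
  obtain ⟨C, hC, hCε⟩ := le_gaussianReal_setOf_abs_sub_lt (‖A f‖₊ ^ 2)
    (by simpa using hf) (s * (r / 2) / (‖x‖ + 1)) (by positivity)
  have hZprob : IsProbabilityMeasure (ν.map Z) := Measure.isProbabilityMeasure_map hZc.aemeasurable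
  have hev1 : ∀ᶠ ε in 𝓝[>] (0 : ℝ), ε < 1 := nhdsWithin_le_nhds (gt_mem_nhds one_pos)
  refine ⟨C * (1 / 2), by positivity, ?_⟩
  filter_upwards [eventually_half_le_measure (ν.map Z) (r / 2) (half_pos hr), hev1,
    self_mem_nhdsWithin] with ε hε1 hε2 hε3
  have h1 := hCε ε hε3 hε2
  have hcs : ((‖A f‖₊ ^ 2 : ℝ≥0) : ℝ) = s := by simp [hs]
  rw [hcs, ← h.map_inner] at h1
  have hm1 : MeasurableSet {y : ℝ | |√ε * y - s| < s * (r / 2) / (‖x‖ + 1)} :=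
    measurableSet_lt (by fun_prop) (by fun_prop)
  have hm2 : MeasurableSet {z : H | ‖√ε • z‖ < r / 2} :=
    measurableSet_lt (by fun_prop) (by fun_prop)
  rw [Measure.map_apply (by fun_prop) hm1] at h1
  rw [Measure.map_apply hZc hm2] at hε1
  calc ENNReal.ofReal (C * (1 / 2) * Real.exp (-(s / 2) / ε))
      = ENNReal.ofReal (C * Real.exp (-(s / 2) / ε)) * (1 / 2) := by
        rw [hhalf, ← ENNReal.ofReal_mul (by positivity)]
        congr 1; ring
    _ ≤ _ := mul_le_mul' h1 hε1
    _ = _ := (hind.measure_inter_preimage_eq_mul _ _ hm1 hm2).symm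
    _ ≤ _ := by
        refine measure_mono fun z hz => ?_
        obtain ⟨hz1, hz2⟩ := hz
        simp only [Set.mem_preimage, Set.mem_ofPred_eq] at hz1 hz2
        rw [Set.mem_ofPred_eq, mem_ball_iff_norm]
        -- The error splits into the scaled residual and the deviation of `√ε ⟪f, z⟫` from `s`, each
        -- contributing at most `r / 2`.
        have hdec : √ε • z - x = √ε • Z z + (s⁻¹ * (√ε * ⟪f, z⟫ - s)) • x := by
          simp only [hZ, smul_sub, smul_smul, mul_sub, sub_smul, inv_mul_cancel₀ hs0.ne', one_smul]
          rw [mul_left_comm s⁻¹]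
          abel
        rw [hdec]
        have hb : ‖(s⁻¹ * (√ε * ⟪f, z⟫ - s)) • x‖ ≤ r / 2 := by
          rw [norm_smul, norm_mul, Real.norm_eq_abs (_ - _), Real.norm_of_nonneg (by positivity)]
          calc s⁻¹ * |√ε * ⟪f, z⟫ - s| * ‖x‖
              ≤ s⁻¹ * (s * (r / 2) / (‖x‖ + 1)) * (‖x‖ + 1) := by gcongr; linarith
            _ = r / 2 := by field_simp
        linarith [norm_add_le (√ε • Z z) ((s⁻¹ * (√ε * ⟪f, z⟫ - s)) • x)]

/-- The large deviation principle for the rescaled Gaussian measures. -/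
theorem satisfiesLDP (h : IsCentredGaussian ν A) (e : H) (I : H → ℝ≥0∞)
    (hI : ∀ (x : H) (a : ℝ≥0), I x ≤ a ↔ ∃ g, ‖g‖ ^ 2 ≤ 2 * a ∧ e + A.adjoint g = x) :
    FlowLDP.SatisfiesLDP ν (fun ε z => e + √ε • z) I := by
  have hP := h.isProbabilityMeasure
  refine ⟨?_, ?_, ?_⟩
  · rw [lowerSemicontinuous_iff_isClosed_preimage]
    intro b
    induction b with
    | top => simp
    | coe a =>
      have hset : I ⁻¹' Set.Iic (a : ℝ≥0∞) = ⋂ f, {x | ⟪f, x - e⟫ ≤ √(2 * a) * ‖A f‖} := by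
        ext x
        simp only [Set.mem_preimage, Set.mem_Iic, hI, Set.mem_iInter, Set.mem_ofPred_eq]
        constructor
        · rintro ⟨g, hg, rfl⟩ f
          rw [add_sub_cancel_left, ContinuousLinearMap.adjoint_inner_right, mul_comm]
          refine (real_inner_le_norm _ _).trans ?_
          gcongr
          exact Real.le_sqrt_of_sq_le hg
        · intro hx
          obtain ⟨g, hg, hgx⟩ := exists_adjoint_eq_of_inner_le A (x - e) _ (by positivity) hx
          refine ⟨g, ?_, by rw [hgx]; abel⟩
          calc ‖g‖ ^ 2 ≤ √(2 * a) ^ 2 := by gcongr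
            _ = _ := Real.sq_sqrt (by positivity)
      rw [hset]
      exact isClosed_iInter fun f => isClosed_le (by fun_prop) (by fun_prop)
  · intro F hF
    rw [EReal.le_neg, ← EReal.ge_of_forall_gt_iff_ge]
    intro a ha
    rw [EReal.le_neg, ← EReal.coe_neg]
    -- For negative `a` the bound is weaker than probability at most one.
    rcases lt_or_ge a 0 with ha0 | ha0
    · refine limsup_mul_log_le _ a 1 one_pos ?_
      filter_upwards [self_mem_nhdsWithin] with ε hε
      refine prob_le_one.trans ?_
      rw [← ENNReal.ofReal_one, one_mul]
      refine ENNReal.ofReal_le_ofReal (Real.one_le_exp ?_)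
      exact div_nonneg (by linarith) (le_of_lt hε)
    · lift a to ℝ≥0 using ha0
      obtain ⟨C, hC, hle⟩ := h.measure_smul_mem_le ((fun z => e + z) ⁻¹' F)
        (hF.preimage (by fun_prop)) a a.2 fun g hg hmem => by
          have h1 : I (e + A.adjoint g) ≤ a := (hI _ _).2 ⟨g, hg, rfl⟩
          have h2 : (I (e + A.adjoint g) : EReal) ≤ (a : ℝ) := by
            rw [← EReal.coe_nnreal_eq_coe_real]
            exact EReal.coe_ennreal_le_coe_ennreal_iff.2 h1
          exact absurd (ha.trans_le (iInf₂_le (e + A.adjoint g) hmem)) (not_lt.2 h2)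
      exact limsup_mul_log_le _ a C hC hle
  · intro G hG
    rw [EReal.neg_le]
    refine le_iInf₂ fun x hx => ?_
    rw [EReal.neg_le]
    by_cases htop : I x = ∞
    · simp [htop]
    lift I x to ℝ≥0 using htop with a ha
    obtain ⟨g, hg, hgx⟩ := (hI x a).1 ha.ge
    rw [← EReal.ge_of_forall_gt_iff_ge]
    intro b hb
    have hb' : b < -a := by
      rw [EReal.coe_nnreal_eq_coe_real, ← EReal.coe_neg] at hb
      exact_mod_cast hb
    obtain ⟨r₁, hr₁, hball⟩ := Metric.isOpen_iff.1 hG x hx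
    have hsmall : ∀ᶠ r in 𝓝[>] (0 : ℝ), (‖g‖ + r) ^ 2 / 2 < -b := by
      have : Tendsto (fun r : ℝ => (‖g‖ + r) ^ 2 / 2) (𝓝 0) (𝓝 ((‖g‖ + 0) ^ 2 / 2)) :=
        Continuous.tendsto (by fun_prop) 0
      refine nhdsWithin_le_nhds (this.eventually (gt_mem_nhds ?_))
      rw [add_zero]
      linarith
    have hr₂ : ∀ᶠ r in 𝓝[>] (0 : ℝ), r < r₁ / 2 :=
      nhdsWithin_le_nhds (gt_mem_nhds (half_pos hr₁))
    obtain ⟨r, ⟨hrb, hr⟩, hr0⟩ := ((hsmall.and hr₂).and self_mem_nhdsWithin).exists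
    replace hr0 : 0 < r := hr0
    obtain ⟨f, hf, hfd⟩ := A.exists_adjoint_apply_near g r hr0
    obtain ⟨C, hC, hle⟩ := h.le_measure_smul_mem_ball f r hr0
    rw [← neg_neg b]
    refine le_liminf_mul_log _ (-b) C hC ?_
    filter_upwards [hle, self_mem_nhdsWithin] with ε h1 hε
    replace hε : 0 < ε := hε
    refine le_trans (ENNReal.ofReal_le_ofReal ?_) (h1.trans (measure_mono fun z hz => ?_))
    · have : ‖A f‖ ^ 2 / 2 ≤ -b := le_trans (by gcongr) hrb.le
      gcongr
    · refine hball ?_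
      rw [Metric.mem_ball]
      have h2 : dist (√ε • z) (A.adjoint (A f)) < r := hz
      have h3 := dist_triangle (√ε • z) (A.adjoint (A f)) (A.adjoint g)
      rw [← hgx, dist_add_left]
      linarith

end IsCentredGaussian

/-! ### Transfer to random elements. -/

section Transfer

open scoped RealInnerProductSpace

variable {H K : Type*} [NormedAddCommGroup H] [InnerProductSpace ℝ H] [CompleteSpace H]
  [SecondCountableTopology H] [MeasurableSpace H] [BorelSpace H]
  [NormedAddCommGroup K] [InnerProductSpace ℝ K] [CompleteSpace K]

/-- Cramér–Wold: the characteristic function at `f` is that of the projection along `f`, evaluated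
at `1`. -/
theorem MeasureTheory.Measure.ext_of_map_inner {μ ν : Measure H} [IsFiniteMeasure μ]
    [IsFiniteMeasure ν] (h : ∀ f, μ.map (fun z => ⟪f, z⟫) = ν.map (fun z => ⟪f, z⟫)) : μ = ν := by
  refine Measure.ext_of_charFun (funext fun f => ?_)
  have key (ρ : Measure H) : charFun ρ f = charFun (ρ.map (fun z => ⟪f, z⟫)) 1 := by
    rw [charFun_apply, charFun_apply, integral_map (by fun_prop) (by fun_prop)]
    simp [real_inner_comm]
  rw [key, key, h]

/-- The large deviation principle for a family of Gaussian random elements with mean `e` and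
covariance operator `ε A† A`. -/
theorem satisfiesLDP_of_map_inner_eq_gaussianReal {Ω : Type*} [MeasurableSpace Ω] (P : Measure Ω)
    [IsProbabilityMeasure P] (A : H →L[ℝ] K) (e : H) (I : H → ℝ≥0∞)
    (hI : ∀ (x : H) (a : ℝ≥0), I x ≤ a ↔ ∃ g, ‖g‖ ^ 2 ≤ 2 * a ∧ e + A.adjoint g = x)
    (X : ℝ → Ω → H) (hX : ∀ ε, 0 < ε → AEMeasurable (X ε) P)
    (hlaw : ∀ ε : ℝ, 0 < ε → ∀ f, P.map (fun ω => ⟪f, X ε ω - e⟫) =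
      gaussianReal 0 (ε.toNNReal * ‖A f‖₊ ^ 2)) :
    FlowLDP.SatisfiesLDP P X I := by
  have hXe (ε : ℝ) (hε : 0 < ε) : AEMeasurable (fun ω => X ε ω - e) P :=
    (hX ε hε).sub_const e
  have hmap (ε : ℝ) (hε : 0 < ε) (f : H) : (P.map (fun ω => X ε ω - e)).map (fun z => ⟪f, z⟫) =
      gaussianReal 0 (ε.toNNReal * ‖A f‖₊ ^ 2) := by
    rw [AEMeasurable.map_map_of_aemeasurable (by fun_prop) (hXe ε hε), ← hlaw ε hε f]
    rfl
  set ν := P.map (fun ω => X 1 ω - e) with hν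
  have hprob : IsProbabilityMeasure ν := Measure.isProbabilityMeasure_map (hXe 1 one_pos)
  have hcent : IsCentredGaussian ν A := ⟨hprob, fun f => by simpa using hmap 1 one_pos f⟩
  -- Every noise level is compared with the reference level `1`; only laws matter, not the coupling
  -- in `ε`.
  have heq (ε : ℝ) (hε : 0 < ε) : P.map (fun ω => X ε ω - e) = ν.map (fun z => √ε • z) := by
    refine Measure.ext_of_map_inner fun f => ?_
    rw [hmap ε hε, Measure.map_map (by fun_prop) (by fun_prop)]
    have : (fun z : H => ⟪f, z⟫) ∘ (fun z => √ε • z) = (fun x => √ε * x) ∘ fun z => ⟪f, z⟫ := by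
      ext z; simp [inner_smul_right]
    rw [this, ← Measure.map_map (by fun_prop) (by fun_prop), hcent.map_inner,
      gaussianReal_map_const_mul]
    rw [mul_zero]
    congr 1
    refine congrArg (· * _) (NNReal.eq ?_)
    rw [Real.coe_toNNReal _ hε.le]
    exact (Real.sq_sqrt hε.le).symm
  have hmeas (ε : ℝ) (hε : 0 < ε) (F : Set H) (hF : MeasurableSet F) :
      P {ω | X ε ω ∈ F} = ν {z | e + √ε • z ∈ F} := by
    have h1 : MeasurableSet ((fun z => e + z) ⁻¹' F) := hF.preimage (by fun_prop)
    have h2 := congrArg (fun ρ => ρ ((fun z => e + z) ⁻¹' F)) (heq ε hε)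
    rw [Measure.map_apply_of_aemeasurable (hXe ε hε) h1, Measure.map_apply (by fun_prop) h1] at h2
    rw [show {ω | X ε ω ∈ F} = (fun ω => X ε ω - e) ⁻¹' ((fun z => e + z) ⁻¹' F) by ext; simp, h2]
    rfl
  obtain ⟨hlsc, hup, hlow⟩ := hcent.satisfiesLDP e I hI
  refine ⟨hlsc, fun F hF => ?_, fun G hG => ?_⟩
  · refine le_trans (le_of_eq (limsup_congr ?_)) (hup F hF)
    filter_upwards [self_mem_nhdsWithin] with ε hε
    rw [hmeas ε hε F hF.measurableSet]
  · refine (hlow G hG).trans (le_of_eq (liminf_congr ?_))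
    filter_upwards [self_mem_nhdsWithin] with ε hε
    rw [hmeas ε hε G hG.measurableSet]

end Transfer

/-! ### Continuity of characteristic functions in `L²`. -/

section CharacteristicFunction

variable {Ω : Type*} [MeasurableSpace Ω] {P : Measure Ω} [IsProbabilityMeasure P]

/-- Lipschitz with constant `|u|`, by `|exp(ia) - exp(ib)| ≤ |a - b|` and the domination of the `L¹`
norm by the `L²` norm on a probability space. It carries Gaussian laws to `L²` limits. -/
theorem MeasureTheory.Lp.continuous_integral_cexp (u : ℝ) :
    Continuous fun X : Lp ℝ 2 P => ∫ ω, Complex.exp (u * X ω * Complex.I) ∂P := by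
  have hint (X : Lp ℝ 2 P) : Integrable (fun ω => Complex.exp (u * X ω * Complex.I)) P := by
    refine Integrable.of_bound (C := 1) ?_ (ae_of_all _ fun ω => ?_)
    · have := (Lp.aestronglyMeasurable X).aemeasurable
      exact AEMeasurable.aestronglyMeasurable (by fun_prop)
    · rw [← Complex.ofReal_mul, Complex.norm_exp_ofReal_mul_I]
  have hlip (X Y : Lp ℝ 2 P) : ‖(∫ ω, Complex.exp (u * X ω * Complex.I) ∂P) -
      ∫ ω, Complex.exp (u * Y ω * Complex.I) ∂P‖ ≤ |u| * ‖X - Y‖ := by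
    rw [← integral_sub (hint X) (hint Y)]
    have hXY : Integrable (fun ω => |u| * ‖(X - Y) ω‖) P :=
      ((Lp.memLp (X - Y)).integrable (by norm_num)).norm.const_mul _
    calc _ ≤ ∫ ω, |u| * ‖(X - Y) ω‖ ∂P := by
          refine norm_integral_le_of_norm_le hXY ?_
          filter_upwards [Lp.coeFn_sub X Y] with ω hω
          have h := Real.norm_exp_I_mul_ofReal_sub_one_le (x := u * X ω - u * Y ω)
          have hfac : Complex.exp (u * X ω * Complex.I) - Complex.exp (u * Y ω * Complex.I) =
              Complex.exp ((u * Y ω : ℝ) * Complex.I) *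
                (Complex.exp (Complex.I * (u * X ω - u * Y ω : ℝ)) - 1) := by
            rw [mul_sub, ← Complex.exp_add, mul_one]
            congr 2 <;> push_cast <;> ring
          rw [hfac, norm_mul, Complex.norm_exp_ofReal_mul_I, one_mul]
          refine h.trans_eq ?_
          rw [← mul_sub, norm_mul, hω, Pi.sub_apply, Real.norm_eq_abs]
      _ = |u| * ∫ ω, ‖(X - Y) ω‖ ∂P := integral_const_mul _ _
      _ ≤ _ := by
          gcongr
          rw [integral_norm_eq_lintegral_enorm (Lp.aestronglyMeasurable _), Lp.norm_def,
            ← eLpNorm_one_eq_lintegral_enorm]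
          exact ENNReal.toReal_mono (Lp.eLpNorm_ne_top _)
            (eLpNorm_le_eLpNorm_of_exponent_le (by norm_num) (Lp.aestronglyMeasurable _))
  refine (LipschitzWith.of_dist_le_mul (K := Real.nnabs u) fun X Y => ?_).continuous
  rw [dist_eq_norm_sub, dist_eq_norm_sub, Real.coe_nnabs]
  exact hlip X Y

end CharacteristicFunction

theorem MeasureTheory.Lp.norm_sq_eq_integral {S : Type*} [MeasurableSpace S] {μ : Measure S}
    (f : Lp ℝ 2 μ) : ‖f‖ ^ 2 = ∫ q, f q ^ 2 ∂μ := by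
  rw [← real_inner_self_eq_norm_sq, L2.inner_def]
  refine integral_congr_ae (ae_of_all _ fun q => ?_)
  simp [pow_two]

/-! ### The Wiener integral as an isometry. -/

namespace FlowLDP.IsWienerSheet

set_option linter.unusedSectionVars false

attribute [local instance] Lp.simpleFunc.module

variable {Ω : Type*} [MeasurableSpace Ω] {P : Measure Ω} [IsProbabilityMeasure P]
  {W : Set (ℝ × ℝ) → Ω → ℝ}

theorem memLp (hW : IsWienerSheet P W) {A : Set (ℝ × ℝ)} (hA : MeasurableSet A)
    (hA' : sheetMeasure A ≠ ∞) : MemLp (W A) 2 P :=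
  (hW.law A hA hA').hasGaussianLaw.memLp (by norm_num)

open Classical in
/-- The value of the sheet as an element of `L²(P)`. -/
noncomputable def toLp (hW : IsWienerSheet P W) (A : Set (ℝ × ℝ)) : Lp ℝ 2 P :=
  if h : MeasurableSet A ∧ sheetMeasure A ≠ ∞ then (hW.memLp h.1 h.2).toLp (W A) else 0

theorem coeFn_toLp (hW : IsWienerSheet P W) {A : Set (ℝ × ℝ)} (hA : MeasurableSet A)
    (hA' : sheetMeasure A ≠ ∞) : hW.toLp A =ᵐ[P] W A := by
  rw [toLp, dif_pos ⟨hA, hA'⟩]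
  exact MemLp.coeFn_toLp _

/-- The `L²(P)`-valued vector measure `A ↦ W A`, acting on scalars. -/
noncomputable def vectorMeasure (hW : IsWienerSheet P W) (A : Set (ℝ × ℝ)) : ℝ →L[ℝ] Lp ℝ 2 P :=
  ContinuousLinearMap.toSpanSingleton ℝ (hW.toLp A)

theorem finMeasAdditive (hW : IsWienerSheet P W) :
    FinMeasAdditive sheetMeasure hW.vectorMeasure := by
  intro A B hA hB hA' hB' hAB
  ext1
  simp only [vectorMeasure, add_apply,
    ContinuousLinearMap.toSpanSingleton_apply, one_smul]
  refine Lp.ext ?_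
  filter_upwards [hW.coeFn_toLp hA hA', hW.coeFn_toLp hB hB',
    hW.coeFn_toLp (hA.union hB) (measure_union_ne_top hA' hB'), hW.additive A B hA hA' hB hB' hAB,
    Lp.coeFn_add (hW.toLp A) (hW.toLp B)] with ω h1 h2 h3 h4 h5
  rw [h5, h3, h4, Pi.add_apply, h1, h2]

theorem vectorMeasure_of_null (hW : IsWienerSheet P W) (A : Set (ℝ × ℝ)) (hA : MeasurableSet A)
    (hA0 : sheetMeasure A = 0) : hW.vectorMeasure A = 0 := by
  ext1
  simp only [vectorMeasure, zero_apply,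
    ContinuousLinearMap.toSpanSingleton_apply, one_smul]
  have hA' : sheetMeasure A ≠ ∞ := by simp [hA0]
  have hlaw := hW.law A hA hA'
  rw [hA0, ENNReal.toNNReal_zero, gaussianReal_zero_var] at hlaw
  have hz : ∀ᵐ x ∂(P.map (W A)), x = 0 := by
    rw [hlaw.map_eq]
    exact (ae_dirac_iff (measurableSet_eq)).2 rfl
  refine Lp.ext ?_
  filter_upwards [hW.coeFn_toLp hA hA', ae_of_ae_map hlaw.aemeasurable hz,
    Lp.coeFn_zero ℝ 2 P] with ω h1 h2 h3
  rw [h1, h2, h3, Pi.zero_apply]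

theorem coeFn_setToSimpleFunc (hW : IsWienerSheet P W) (g : SimpleFunc (ℝ × ℝ) ℝ)
    (hg : Integrable g sheetMeasure) :
    (g.setToSimpleFunc hW.vectorMeasure : Lp ℝ 2 P) =ᵐ[P] simpleSheetIntegral W g := by
  classical
  -- The fibre over `0` is left out on both sides; it may have infinite measure.
  have h1 : g.setToSimpleFunc hW.vectorMeasure = ∑ c ∈ g.range.erase 0, c • hW.toLp (g ⁻¹' {c}) := by
    rw [SimpleFunc.setToSimpleFunc_eq_sum_filter]
    refine Finset.sum_congr ?_ fun c _ => rfl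
    ext c; simp [and_comm]
  have h2 : ∀ᵐ ω ∂P, ∀ c ∈ g.range.erase 0, hW.toLp (g ⁻¹' {c}) ω = W (g ⁻¹' {c}) ω := by
    refine (eventually_all_finset _).2 ?_
    intro c hc
    exact hW.coeFn_toLp (g.measurableSet_fiber c)
      (SimpleFunc.measure_preimage_lt_top_of_integrable g hg (Finset.ne_of_mem_erase hc)).ne
  have h3 : ∀ᵐ ω ∂P, ∀ c ∈ g.range.erase 0,
      (c • hW.toLp (g ⁻¹' {c})) ω = c * hW.toLp (g ⁻¹' {c}) ω := by
    refine (eventually_all_finset _).2 ?_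
    intro c _
    filter_upwards [Lp.coeFn_smul c (hW.toLp (g ⁻¹' {c}))] with ω hω
    rw [hω]; rfl
  rw [h1]
  filter_upwards [h2, h3, Lp.coeFn_finsetSum (g.range.erase 0)
    (fun c => c • hW.toLp (g ⁻¹' {c}))] with ω h2 h3 h4
  rw [h4, simpleSheetIntegral, Finset.sum_apply]
  exact Finset.sum_congr rfl fun c hc => by rw [h3 c hc, h2 c hc]

/-- The fibres of `g` are disjoint, so the terms are independent centred Gaussians, and their
variances `c² |{g = c}|` add up to `∫ g²`. -/
theorem map_simpleSheetIntegral (hW : IsWienerSheet P W) (g : SimpleFunc (ℝ × ℝ) ℝ)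
    (hg : Integrable g sheetMeasure) :
    P.map (simpleSheetIntegral W g) =
      gaussianReal 0 (∫ q, g q ^ 2 ∂sheetMeasure).toNNReal := by
  classical
  set R := g.range.erase 0 with hR
  have hfin (c : R) : MeasurableSet (g ⁻¹' {(c : ℝ)}) ∧ sheetMeasure (g ⁻¹' {(c : ℝ)}) ≠ ∞ :=
    ⟨g.measurableSet_fiber _, (SimpleFunc.measure_preimage_lt_top_of_integrable g hg
      (Finset.ne_of_mem_erase c.2)).ne⟩
  have hind : iIndepFun (fun c : R => W (g ⁻¹' {(c : ℝ)})) P := by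
    have h := hW.indep R.card (fun i => g ⁻¹' {((R.equivFin.symm i : R) : ℝ)})
      (fun i => hfin _) fun i j hij => by
        refine Disjoint.preimage _ (Set.disjoint_singleton.2 fun h => hij ?_)
        exact R.equivFin.symm.injective (Subtype.ext h)
    have h' := h.precomp R.equivFin.injective
    simpa [Function.comp_def] using! h'
  have hind' : iIndepFun (fun (c : R) ω => (c : ℝ) * W (g ⁻¹' {(c : ℝ)}) ω) P :=
    hind.comp (fun c x => (c : ℝ) * x) fun c => by fun_prop
  have hlaw (c : R) : HasLaw (fun ω => (c : ℝ) * W (g ⁻¹' {(c : ℝ)}) ω)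
      (gaussianReal 0 (.mk ((c : ℝ) ^ 2) (sq_nonneg _) *
        (sheetMeasure (g ⁻¹' {(c : ℝ)})).toNNReal)) P := by
    have := gaussianReal_const_mul (hW.law _ (hfin c).1 (hfin c).2) (c : ℝ)
    simpa using this
  have hG := iIndepFun.hasGaussianLaw_fun_sum (fun c => (hlaw c).hasGaussianLaw) hind'
  have hL2 (c : R) : MemLp (fun ω => (c : ℝ) * W (g ⁻¹' {(c : ℝ)}) ω) 2 P :=
    (hlaw c).hasGaussianLaw.memLp (by norm_num)
  have heq : simpleSheetIntegral W g = fun ω => ∑ c : R, (c : ℝ) * W (g ⁻¹' {(c : ℝ)}) ω := by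
    ext ω
    rw [simpleSheetIntegral, ← Finset.sum_coe_sort]
  have hmean : P[fun ω => ∑ c : R, (c : ℝ) * W (g ⁻¹' {(c : ℝ)}) ω] = 0 := by
    rw [integral_finsetSum _ fun c _ => (hL2 c).integrable (by norm_num)]
    refine Finset.sum_eq_zero fun c _ => ?_
    have := (hlaw c).integral_eq
    rwa [integral_id_gaussianReal] at this
  have hvar : Var[fun ω => ∑ c : R, (c : ℝ) * W (g ⁻¹' {(c : ℝ)}) ω; P] =
      ∫ q, g q ^ 2 ∂sheetMeasure := by
    have h1 := IndepFun.variance_sum (s := Finset.univ) (fun c _ => hL2 c)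
      fun c _ c' _ hcc' => hind'.indepFun hcc'
    have h2 (c : R) : Var[fun ω => (c : ℝ) * W (g ⁻¹' {(c : ℝ)}) ω; P] =
        sheetMeasure.real (g ⁻¹' {(c : ℝ)}) * (c : ℝ) ^ 2 := by
      rw [(hlaw c).variance_eq, variance_id_gaussianReal]
      rw [NNReal.coe_mul, mul_comm]
      rfl
    have hsq : MemLp (g.map fun x : ℝ => x ^ 2) 1 sheetMeasure := by
      have : MemLp g 2 sheetMeasure := (SimpleFunc.memLp_iff_integrable (by simp) (by simp)).2 hg
      exact memLp_one_iff_integrable.2 this.integrable_sq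
    have h3 : ∫ q, g q ^ 2 ∂sheetMeasure = ∑ c ∈ g.range, sheetMeasure.real (g ⁻¹' {c}) • c ^ 2 := by
      rw [← SimpleFunc.map_integral g (fun x : ℝ => x ^ 2) hg (by simp),
        SimpleFunc.integral_eq_integral]
      · rfl
      · rw [← SimpleFunc.memLp_iff_integrable one_ne_zero ENNReal.one_ne_top]
        exact hsq
    have h4 : (∑ c : R, fun ω => (c : ℝ) * W (g ⁻¹' {(c : ℝ)}) ω) =
        fun ω => ∑ c : R, (c : ℝ) * W (g ⁻¹' {(c : ℝ)}) ω := by ext; simp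
    rw [h4] at h1
    rw [h1, h3, Finset.sum_congr rfl fun c _ => h2 c,
      Finset.sum_coe_sort R fun c => sheetMeasure.real (g ⁻¹' {c}) * c ^ 2]
    simp only [smul_eq_mul]
    refine Finset.sum_erase _ (by simp)
  rw [heq, hG.map_eq_gaussianReal, hmean, hvar]

theorem map_setToSimpleFunc (hW : IsWienerSheet P W) (g : Lp.simpleFunc ℝ 2 sheetMeasure) :
    P.map ((Lp.simpleFunc.toSimpleFunc g).setToSimpleFunc hW.vectorMeasure : Lp ℝ 2 P) =
      gaussianReal 0 (‖g‖₊ ^ 2) := by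
  have hgi := (SimpleFunc.memLp_iff_integrable (by simp) (by simp)).1 (Lp.simpleFunc.memLp g)
  rw [Measure.map_congr (hW.coeFn_setToSimpleFunc _ hgi), hW.map_simpleSheetIntegral _ hgi]
  congr 1
  have h1 : ∫ q, Lp.simpleFunc.toSimpleFunc g q ^ 2 ∂sheetMeasure =
      ‖(g : Lp ℝ 2 sheetMeasure)‖ ^ 2 := by
    rw [Lp.norm_sq_eq_integral]
    refine integral_congr_ae ?_
    filter_upwards [Lp.simpleFunc.toSimpleFunc_eq_toFun g] with q hq
    rw [hq]
  rw [h1]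
  ext
  rw [Real.coe_toNNReal _ (by positivity)]
  rfl

theorem norm_setToSimpleFunc (hW : IsWienerSheet P W) (g : Lp.simpleFunc ℝ 2 sheetMeasure) :
    ‖(Lp.simpleFunc.toSimpleFunc g).setToSimpleFunc hW.vectorMeasure‖ = ‖g‖ := by
  set X : Lp ℝ 2 P := (Lp.simpleFunc.toSimpleFunc g).setToSimpleFunc hW.vectorMeasure
  have h1 : ∫ ω, X ω ^ 2 ∂P = ∫ x, x ^ 2 ∂(P.map X) :=
    (integral_map (f := fun x : ℝ => x ^ 2) (Lp.aestronglyMeasurable X).aemeasurable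
      (by fun_prop)).symm
  have h2 : ∫ x, x ^ 2 ∂(gaussianReal 0 (‖g‖₊ ^ 2)) = ‖g‖ ^ 2 := by
    have := variance_of_integral_eq_zero (μ := gaussianReal 0 (‖g‖₊ ^ 2)) (X := fun x : ℝ => x)
      (by fun_prop) integral_id_gaussianReal
    rw [← this, variance_fun_id_gaussianReal]
    simp
  rw [hW.map_setToSimpleFunc, h2, ← Lp.norm_sq_eq_integral] at h1
  exact (sq_eq_sq₀ (norm_nonneg _) (norm_nonneg _)).1 h1

/-- The Wiener integral of a square-integrable function. -/
noncomputable def wienerIntegral (hW : IsWienerSheet P W) :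
    Lp ℝ 2 sheetMeasure →L[ℝ] Lp ℝ 2 P :=
  LinearMap.extendOfNorm
    ({ toFun := fun g => (Lp.simpleFunc.toSimpleFunc g).setToSimpleFunc hW.vectorMeasure
       map_add' := fun f g => by
        rw [← SimpleFunc.setToSimpleFunc_add _ hW.finMeasAdditive
          ((SimpleFunc.memLp_iff_integrable (by simp) (by simp)).1 (Lp.simpleFunc.memLp f))
          ((SimpleFunc.memLp_iff_integrable (by simp) (by simp)).1 (Lp.simpleFunc.memLp g))]
        exact SimpleFunc.setToSimpleFunc_congr _ hW.vectorMeasure_of_null hW.finMeasAdditive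
          ((SimpleFunc.memLp_iff_integrable (by simp) (by simp)).1 (Lp.simpleFunc.memLp (f + g)))
          (Lp.simpleFunc.add_toSimpleFunc f g)
       map_smul' := fun c g => by
        rw [RingHom.id_apply, ← SimpleFunc.setToSimpleFunc_smul_real _ hW.finMeasAdditive c
          ((SimpleFunc.memLp_iff_integrable (by simp) (by simp)).1 (Lp.simpleFunc.memLp g))]
        exact SimpleFunc.setToSimpleFunc_congr _ hW.vectorMeasure_of_null hW.finMeasAdditive
          ((SimpleFunc.memLp_iff_integrable (by simp) (by simp)).1 (Lp.simpleFunc.memLp (c • g)))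
          (Lp.simpleFunc.smul_toSimpleFunc c g) } :
      Lp.simpleFunc ℝ 2 sheetMeasure →ₗ[ℝ] Lp ℝ 2 P)
    (Lp.simpleFunc.coeToLp (ℝ × ℝ) ℝ ℝ : Lp.simpleFunc ℝ 2 sheetMeasure →L[ℝ] Lp ℝ 2 sheetMeasure)

theorem wienerIntegral_coe (hW : IsWienerSheet P W) (g : Lp.simpleFunc ℝ 2 sheetMeasure) :
    hW.wienerIntegral (g : Lp ℝ 2 sheetMeasure) =
      (Lp.simpleFunc.toSimpleFunc g).setToSimpleFunc hW.vectorMeasure :=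
  LinearMap.extendOfNorm_eq (Lp.simpleFunc.denseRange (by simp))
    ⟨1, fun g => by rw [one_mul]; exact (hW.norm_setToSimpleFunc g).le⟩ g

theorem wienerIntegral_toLp (hW : IsWienerSheet P W) (g : SimpleFunc (ℝ × ℝ) ℝ)
    (hg : MemLp g 2 sheetMeasure) :
    hW.wienerIntegral (hg.toLp g) =ᵐ[P] simpleSheetIntegral W g := by
  have hgi := (SimpleFunc.memLp_iff_integrable (by simp) (by simp)).1 hg
  have h1 : hg.toLp g = (SimpleFunc.toLp g hg : Lp ℝ 2 sheetMeasure) := rfl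
  rw [h1, wienerIntegral_coe, SimpleFunc.setToSimpleFunc_congr _ hW.vectorMeasure_of_null
    hW.finMeasAdditive ((SimpleFunc.memLp_iff_integrable (by simp) (by simp)).1
      (Lp.simpleFunc.memLp (SimpleFunc.toLp g hg))) (Lp.simpleFunc.toSimpleFunc_toLp g hg)]
  exact hW.coeFn_setToSimpleFunc g hgi

/-- Uniqueness of `L²` limits: any version of the integral agrees with the continuous extension,
whichever approximating sequence was used. -/
theorem ae_eq_wienerIntegral (hW : IsWienerSheet P W) {f : ℝ × ℝ → ℝ} {X : Ω → ℝ}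
    (hX : IsWienerIntegral P W f X) : X =ᵐ[P] hW.wienerIntegral (hX.1.toLp f) := by
  obtain ⟨hf, hXm, g, hg, hgf, hgX⟩ := hX
  have hsimple (n : ℕ) := hW.wienerIntegral_toLp (g n) (hg n)
  have h1 : Tendsto (fun n => (hg n).toLp (g n)) atTop (𝓝 (hf.toLp f)) := by
    rw [Lp.tendsto_Lp_iff_tendsto_eLpNorm'']
    refine hgf.congr fun n => ?_
    rw [← eLpNorm_neg]
    congr 1
    ext q
    simp
  have h2 := (hW.wienerIntegral.continuous.tendsto _).comp h1
  have hdiff (n : ℕ) : eLpNorm (fun ω => X ω - simpleSheetIntegral W (g n) ω) 2 P =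
      eLpNorm (fun ω => X ω - hW.wienerIntegral ((hg n).toLp (g n)) ω) 2 P := by
    refine eLpNorm_congr_ae ?_
    filter_upwards [hsimple n] with ω hω
    rw [hω]
  -- Square-integrability of `X` follows because `X` is at finite `L²` distance from one simple
  -- integral.
  have hXL : MemLp X 2 P := by
    obtain ⟨n, hn⟩ := (hgX.eventually (gt_mem_nhds ENNReal.zero_lt_top)).exists
    rw [hdiff] at hn
    have h3 : MemLp (fun ω => X ω - hW.wienerIntegral ((hg n).toLp (g n)) ω) 2 P :=
      ⟨hXm.sub (Lp.aestronglyMeasurable _), hn⟩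
    have h4 := h3.add (Lp.memLp (hW.wienerIntegral ((hg n).toLp (g n))))
    refine h4.ae_eq (ae_of_all _ fun ω => ?_)
    simp
  have h5 : Tendsto (fun n => hW.wienerIntegral ((hg n).toLp (g n))) atTop (𝓝 (hXL.toLp X)) := by
    rw [Lp.tendsto_Lp_iff_tendsto_eLpNorm]
    refine hgX.congr fun n => ?_
    rw [hdiff, ← eLpNorm_neg]
    congr 1
    ext q
    simp
  rw [tendsto_nhds_unique h2 h5]
  exact (MemLp.coeFn_toLp hXL).symm

theorem map_wienerIntegral (hW : IsWienerSheet P W) (g : Lp ℝ 2 sheetMeasure) :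
    P.map (hW.wienerIntegral g) = gaussianReal 0 (‖g‖₊ ^ 2) := by
  have hmeas (g : Lp ℝ 2 sheetMeasure) : AEMeasurable (hW.wienerIntegral g) P :=
    (Lp.aestronglyMeasurable _).aemeasurable
  have hchar (g : Lp ℝ 2 sheetMeasure) (u : ℝ) : charFun (P.map (hW.wienerIntegral g)) u =
      ∫ ω, Complex.exp (u * hW.wienerIntegral g ω * Complex.I) ∂P := by
    rw [charFun_apply_real, integral_map (hmeas g) (by fun_prop)]
  have hprob : IsProbabilityMeasure (P.map (hW.wienerIntegral g)) :=
    Measure.isProbabilityMeasure_map (hmeas g)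
  refine Measure.ext_of_charFun (funext fun u => ?_)
  rw [hchar, charFun_gaussianReal]
  refine DenseRange.induction_on (p := fun g : Lp ℝ 2 sheetMeasure =>
      ∫ ω, Complex.exp (u * hW.wienerIntegral g ω * Complex.I) ∂P =
      Complex.exp (u * (0 : ℝ) * Complex.I - (‖g‖₊ ^ 2 : ℝ≥0) * u ^ 2 / 2))
    (Lp.simpleFunc.denseRange (by simp)) g (isClosed_eq ?_ ?_) fun g => ?_
  · exact (Lp.continuous_integral_cexp u).comp hW.wienerIntegral.continuous
  · fun_prop
  · rw [← hchar, hW.wienerIntegral_coe, hW.map_setToSimpleFunc, charFun_gaussianReal]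
    rfl

end FlowLDP.IsWienerSheet

/-! ### Convolution, time slabs and the law of the flow. -/

namespace FlowLDP

set_option linter.unusedSectionVars false

open scoped RealInnerProductSpace

theorem memLp_reflected_shift (φ : 𝓢(ℝ, ℝ)) (u : ℝ) : MemLp (fun p => φ (u - p)) 2 volume :=
  (φ.memLp 2 volume).comp_measurePreserving (Measure.measurePreserving_sub_left volume u)

/-- The function `p ↦ φ (u - p)` in `L²(ℝ)`. -/
noncomputable def reflectedShift (φ : 𝓢(ℝ, ℝ)) (u : ℝ) : Lp ℝ 2 (volume : Measure ℝ) :=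
  (memLp_reflected_shift φ u).toLp _

theorem norm_reflectedShift (φ : 𝓢(ℝ, ℝ)) (u : ℝ) :
    ‖reflectedShift φ u‖ = ‖φ.toLp 2 volume‖ := by
  rw [reflectedShift, Lp.norm_toLp, SchwartzMap.norm_toLp]
  congr 1
  exact eLpNorm_comp_measurePreserving φ.continuous.aestronglyMeasurable
    (Measure.measurePreserving_sub_left volume u)

theorem inner_reflectedShift (φ : 𝓢(ℝ, ℝ)) (g : Lp ℝ 2 (volume : Measure ℝ)) (u : ℝ) :
    ⟪reflectedShift φ u, g⟫ = ∫ p, φ (u - p) * g p := by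
  rw [L2.inner_def]
  refine integral_congr_ae ?_
  filter_upwards [MemLp.coeFn_toLp (memLp_reflected_shift φ u)] with p hp
  rw [reflectedShift, hp]
  simp [mul_comm]

theorem aestronglyMeasurable_inner_reflectedShift (φ : 𝓢(ℝ, ℝ))
    (g : Lp ℝ 2 (volume : Measure ℝ)) (ν : Measure ℝ) [SFinite ν] :
    AEStronglyMeasurable (fun u => ⟪reflectedShift φ u, g⟫) ν := by
  simp_rw [inner_reflectedShift]
  refine AEStronglyMeasurable.integral_prod_right' (f := fun z : ℝ × ℝ => φ (z.1 - z.2) * g z.2) ?_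
  have h1 : Continuous fun z : ℝ × ℝ => φ (z.1 - z.2) := φ.continuous.comp (by fun_prop)
  exact h1.aestronglyMeasurable.mul (Lp.aestronglyMeasurable g).comp_snd

theorem abs_inner_reflectedShift_le (φ : 𝓢(ℝ, ℝ)) (g : Lp ℝ 2 (volume : Measure ℝ)) (u : ℝ) :
    ‖⟪reflectedShift φ u, g⟫‖ ≤ ‖φ.toLp 2 volume‖ * ‖g‖ := by
  rw [← norm_reflectedShift φ u]
  exact norm_inner_le_norm _ _

theorem memLp_inner_reflectedShift (φ : 𝓢(ℝ, ℝ)) (g : Lp ℝ 2 (volume : Measure ℝ)) :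
    MemLp (fun u => ⟪reflectedShift φ u, g⟫) 2 (gaussianReal 0 1) :=
  MemLp.of_bound (aestronglyMeasurable_inner_reflectedShift φ g _) _
    (ae_of_all _ (abs_inner_reflectedShift_le φ g))

/-- Convolution with `φ`, as an operator from `L²(ℝ)` to the Gaussian `L²` space. -/
noncomputable def convOp (φ : 𝓢(ℝ, ℝ)) : Lp ℝ 2 (volume : Measure ℝ) →L[ℝ] L2Gauss :=
  LinearMap.mkContinuous
    { toFun := fun g => (memLp_inner_reflectedShift φ g).toLp _
      map_add' := fun f g => by
        rw [← MemLp.toLp_add]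
        congr 1
        ext u
        simp [inner_add_right]
      map_smul' := fun c g => by
        rw [RingHom.id_apply, ← MemLp.toLp_const_smul]
        congr 1
        ext u
        simp [inner_smul_right] }
    ‖φ.toLp 2 volume‖ fun g => by
      refine (Lp.norm_le_of_ae_bound (C := ‖φ.toLp 2 volume‖ * ‖g‖) (by positivity) ?_).trans_eq
        (by simp [measureUnivNNReal])
      filter_upwards [MemLp.coeFn_toLp (memLp_inner_reflectedShift φ g)] with u hu
      exact (congrArg _ hu).trans_le (abs_inner_reflectedShift_le φ g u)

theorem coeFn_convOp (φ : 𝓢(ℝ, ℝ)) (g : Lp ℝ 2 (volume : Measure ℝ)) :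
    convOp φ g =ᵐ[gaussianReal 0 1] fun u => ⟪reflectedShift φ u, g⟫ :=
  MemLp.coeFn_toLp (memLp_inner_reflectedShift φ g)

/-- The tensor product of a function of the space variable and the indicator of `[0, t]`. -/
noncomputable def slab (t : unitInterval) (g : ℝ → ℝ) (q : ℝ × ℝ) : ℝ :=
  g q.1 * (Set.Icc (0 : ℝ) t).indicator 1 q.2

theorem slab_sq (t : unitInterval) (g : ℝ → ℝ) (q : ℝ × ℝ) :
    slab t g q ^ 2 = g q.1 ^ 2 * (Set.Icc (0 : ℝ) t).indicator 1 q.2 := by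
  rw [slab, mul_pow]
  by_cases h : q.2 ∈ Set.Icc (0 : ℝ) t <;> simp [h]

theorem memLp_slab (t : unitInterval) {g : ℝ → ℝ} (hg : MemLp g 2 volume) :
    MemLp (slab t g) 2 sheetMeasure := by
  have hind : Measurable ((Set.Icc (0 : ℝ) t).indicator (1 : ℝ → ℝ)) :=
    measurable_one.indicator measurableSet_Icc
  have hmeas : AEStronglyMeasurable (slab t g) sheetMeasure :=
    hg.1.comp_fst.mul (hind.comp measurable_snd).aestronglyMeasurable
  rw [memLp_two_iff_integrable_sq hmeas]
  simp_rw [slab_sq]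
  refine Integrable.mul_prod hg.integrable_sq (Integrable.mono_measure ?_ Measure.restrict_le_self)
  exact (integrable_indicator_iff measurableSet_Icc).2 (integrableOn_const (by simp))

theorem integral_slab_sq (t : unitInterval) (g : ℝ → ℝ) :
    ∫ q, slab t g q ^ 2 ∂sheetMeasure = t * ∫ p, g p ^ 2 := by
  simp_rw [slab_sq]
  rw [sheetMeasure, integral_prod_mul (fun p => g p ^ 2), integral_indicator_one measurableSet_Icc,
    measureReal_restrict_apply measurableSet_Icc, Set.inter_eq_left.2 fun x hx => hx.1,
    Real.volume_real_Icc, sub_zero, max_eq_left t.2.1, mul_comm]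

theorem norm_toLp_slab_sq (t : unitInterval) (g : Lp ℝ 2 (volume : Measure ℝ)) :
    ‖(memLp_slab t (Lp.memLp g)).toLp _‖ ^ 2 = t * ‖g‖ ^ 2 := by
  rw [Lp.norm_sq_eq_integral, Lp.norm_sq_eq_integral, ← integral_slab_sq]
  refine integral_congr_ae ?_
  filter_upwards [MemLp.coeFn_toLp (memLp_slab t (Lp.memLp g))] with q hq
  rw [hq]

theorem slab_congr (t : unitInterval) {g g' : ℝ → ℝ} (h : g =ᵐ[volume] g') :
    slab t g =ᵐ[sheetMeasure] slab t g' := by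
  have := (Measure.quasiMeasurePreserving_fst (μ := (volume : Measure ℝ))
    (ν := (volume : Measure ℝ).restrict (Set.Ici 0))).ae_eq_comp h
  filter_upwards [this] with q hq
  simp only [Function.comp_apply] at hq
  rw [slab, slab, hq]

/-- Tensoring with the indicator of `[0, t]`, as an operator between `L²` spaces. -/
noncomputable def slabOp (t : unitInterval) :
    Lp ℝ 2 (volume : Measure ℝ) →L[ℝ] Lp ℝ 2 sheetMeasure :=
  LinearMap.mkContinuous
    { toFun := fun g => (memLp_slab t (Lp.memLp g)).toLp _
      map_add' := fun f g => by
        rw [← MemLp.toLp_add, MemLp.toLp_eq_toLp_iff]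
        refine (slab_congr t (Lp.coeFn_add f g)).trans (ae_of_all _ fun q => ?_)
        simp [slab, add_mul]
      map_smul' := fun c g => by
        rw [RingHom.id_apply, ← MemLp.toLp_const_smul, MemLp.toLp_eq_toLp_iff]
        refine (slab_congr t (Lp.coeFn_smul c g)).trans (ae_of_all _ fun q => ?_)
        simp [slab, mul_assoc] }
    1 fun g => by
      rw [one_mul]
      refine (sq_le_sq₀ (norm_nonneg _) (norm_nonneg _)).1 ((norm_toLp_slab_sq t g).trans_le ?_)
      exact mul_le_of_le_one_left (by positivity) t.2.2

theorem norm_slabOp_sq (t : unitInterval) (g : Lp ℝ 2 (volume : Measure ℝ)) :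
    ‖slabOp t g‖ ^ 2 = t * ‖g‖ ^ 2 :=
  norm_toLp_slab_sq t g

theorem slabOp_reflectedShift (φ : 𝓢(ℝ, ℝ)) (t : unitInterval) (u : ℝ)
    (h : MemLp (fun q : ℝ × ℝ => (Set.Icc (0 : ℝ) t).indicator (fun _ => φ (u - q.1)) q.2) 2
      sheetMeasure) :
    slabOp t (reflectedShift φ u) = h.toLp _ := by
  refine (MemLp.toLp_eq_toLp_iff (memLp_slab t (Lp.memLp (reflectedShift φ u))) h).2 ?_
  refine (slab_congr t (MemLp.coeFn_toLp (memLp_reflected_shift φ u))).trans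
    (ae_of_all _ fun q => ?_)
  rw [slab]
  by_cases hq : q.2 ∈ Set.Icc (0 : ℝ) t <;> simp [hq]

/-- The identity function in the Gaussian `L²` space. -/
noncomputable def identity : L2Gauss := (memLp_id_gaussianReal (μ := 0) (v := 1) 2).toLp id

theorem coeFn_identity : identity =ᵐ[gaussianReal 0 1] fun u => u :=
  MemLp.coeFn_toLp _

namespace IsFrozenFlow

variable {Ω : Type*} [MeasurableSpace Ω] {P : Measure Ω} [IsProbabilityMeasure P]
  {W : Set (ℝ × ℝ) → Ω → ℝ} {φ : 𝓢(ℝ, ℝ)} {ε : ℝ} {y : ℝ → unitInterval → Ω → ℝ}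
  {Y : Ω → C(unitInterval, L2Gauss)}

theorem sub_ae_eq (hy : IsFrozenFlow P W φ ε y Y) (hW : IsWienerSheet P W) (t : unitInterval)
    (u : ℝ) : (fun ω => y u t ω - u) =ᵐ[P]
      fun ω => √ε * hW.wienerIntegral (slabOp t (reflectedShift φ u)) ω := by
  obtain ⟨X, hX, hyX⟩ := hy.solves u t
  have h := hW.ae_eq_wienerIntegral hX
  rw [← slabOp_reflectedShift] at h
  filter_upwards [h, hyX] with ω h1 h2
  rw [h2, h1]
  ring

/-- Joint integrability for Fubini: the `L¹(P)` norm of `y u t - u` is bounded uniformly in `u`,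
since all shifts of `φ` have the same norm, and `f` is integrable for the Gaussian measure. -/
theorem integrable_mul_sub (hy : IsFrozenFlow P W φ ε y Y) (hW : IsWienerSheet P W)
    (t : unitInterval) (f : L2Gauss) :
    Integrable (fun z : ℝ × Ω => f z.1 * (y z.1 t z.2 - z.1)) ((gaussianReal 0 1).prod P) := by
  have hmeas : AEStronglyMeasurable (fun z : ℝ × Ω => f z.1 * (y z.1 t z.2 - z.1))
      ((gaussianReal 0 1).prod P) :=
    (Lp.aestronglyMeasurable f).comp_fst.mul
      ((hy.measurable_field t).sub measurable_fst).aestronglyMeasurable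
  have hint (u : ℝ) : Integrable (fun ω => y u t ω - u) P := by
    refine Integrable.congr ?_ (hy.sub_ae_eq hW t u).symm
    exact ((Lp.memLp _).integrable (by norm_num)).const_mul _
  rw [integrable_prod_iff hmeas]
  refine ⟨ae_of_all _ fun u => (hint u).const_mul (f u), ?_⟩
  have hf : Integrable (fun u => ‖f u‖) (gaussianReal 0 1) :=
    ((Lp.memLp f).integrable (by norm_num)).norm
  refine Integrable.mono' (hf.mul_const (√ε * (‖hW.wienerIntegral‖ * (‖slabOp t‖ *
    ‖φ.toLp 2 volume‖)))) hmeas.norm.integral_prod_right' (ae_of_all _ fun u => ?_)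
  rw [Real.norm_of_nonneg (integral_nonneg fun ω => norm_nonneg _)]
  simp only [norm_mul]
  rw [integral_const_mul]
  gcongr
  have h1 : ∫ ω, ‖y u t ω - u‖ ∂P =
      √ε * ∫ ω, ‖hW.wienerIntegral (slabOp t (reflectedShift φ u)) ω‖ ∂P := by
    rw [← integral_const_mul]
    refine integral_congr_ae ?_
    filter_upwards [hy.sub_ae_eq hW t u] with ω hω
    rw [hω, norm_mul, Real.norm_of_nonneg (Real.sqrt_nonneg _)]
  rw [h1]
  gcongr
  calc ∫ ω, ‖hW.wienerIntegral (slabOp t (reflectedShift φ u)) ω‖ ∂P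
      ≤ ‖hW.wienerIntegral (slabOp t (reflectedShift φ u))‖ := by
        rw [integral_norm_eq_lintegral_enorm (Lp.aestronglyMeasurable _), Lp.norm_def,
          ← eLpNorm_one_eq_lintegral_enorm]
        exact ENNReal.toReal_mono (Lp.eLpNorm_ne_top _)
          (eLpNorm_le_eLpNorm_of_exponent_le (by norm_num) (Lp.aestronglyMeasurable _))
    _ ≤ ‖hW.wienerIntegral‖ * ‖slabOp t (reflectedShift φ u)‖ :=
        ContinuousLinearMap.le_opNorm _ _
    _ ≤ _ := by
        gcongr
        rw [← norm_reflectedShift φ u]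
        exact ContinuousLinearMap.le_opNorm _ _

theorem inner_sub_identity_ae_eq (hy : IsFrozenFlow P W φ ε y Y) (t : unitInterval)
    (f : L2Gauss) : (fun ω => ⟪f, Y ω t - identity⟫) =ᵐ[P]
      fun ω => ∫ u, f u * (y u t ω - u) ∂(gaussianReal 0 1) := by
  filter_upwards [hy.represents] with ω hω
  rw [L2.inner_def]
  refine integral_congr_ae ?_
  filter_upwards [hω t, Lp.coeFn_sub (Y ω t) identity, coeFn_identity] with u h1 h2 h3
  rw [h2, Pi.sub_apply, h1, h3]
  simp [mul_comm]

/-- A stochastic Fubini theorem: the linear functionals of the flow are Wiener integrals. -/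
theorem inner_sub_identity_ae_eq_wienerIntegral (hy : IsFrozenFlow P W φ ε y Y)
    (hW : IsWienerSheet P W) (t : unitInterval) (f : L2Gauss) :
    (fun ω => ⟪f, Y ω t - identity⟫) =ᵐ[P]
      fun ω => √ε * hW.wienerIntegral (slabOp t ((convOp φ).adjoint f)) ω := by
  have hint := hy.integrable_mul_sub hW t f
  refine (hy.inner_sub_identity_ae_eq t f).trans ?_
  refine Integrable.ae_eq_of_forall_setIntegral_eq _ _ hint.integral_prod_right
    (((Lp.memLp _).integrable (by norm_num)).const_mul _) fun E hE _ => ?_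
  have hintE : Integrable (fun z : ℝ × Ω => f z.1 * (y z.1 t z.2 - z.1))
      ((gaussianReal 0 1).prod (P.restrict E)) :=
    hint.mono_measure (Measure.prod_mono le_rfl Measure.restrict_le_self)
  -- Both sides are tested against `1_E`. For fixed `u` the pairing with `χ` is `√ε` times the
  -- convolution of `φ` with `J† χ` at `u`; moving the adjoints back yields `J (C† f)`, with `C` the
  -- operator `convOp φ`.
  set χ : Lp ℝ 2 P := indicatorConstLp 2 hE (measure_ne_top P E) 1 with hχ
  set J : Lp ℝ 2 (volume : Measure ℝ) →L[ℝ] Lp ℝ 2 P := hW.wienerIntegral ∘L slabOp t with hJ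
  have hχint (X : Lp ℝ 2 P) : ∫ ω in E, X ω ∂P = ⟪χ, X⟫ := by
    rw [hχ, L2.inner_indicatorConstLp_one]
  calc ∫ ω in E, ∫ u, f u * (y u t ω - u) ∂(gaussianReal 0 1) ∂P
      = ∫ u, ∫ ω in E, f u * (y u t ω - u) ∂P ∂(gaussianReal 0 1) :=
        (integral_integral_swap hintE).symm
    _ = ∫ u, f u * (√ε * ⟪reflectedShift φ u, J.adjoint χ⟫) ∂(gaussianReal 0 1) := by
        refine integral_congr_ae (ae_of_all _ fun u => ?_)
        simp only
        rw [integral_const_mul, integral_congr_ae (ae_restrict_of_ae (hy.sub_ae_eq hW t u)),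
          integral_const_mul, hχint, ContinuousLinearMap.adjoint_inner_right, real_inner_comm]
        rfl
    _ = √ε * ⟪f, convOp φ (J.adjoint χ)⟫ := by
        rw [L2.inner_def, ← integral_const_mul]
        refine integral_congr_ae ?_
        filter_upwards [coeFn_convOp φ (J.adjoint χ)] with u hu
        rw [hu]
        simp only [RCLike.inner_apply, conj_trivial]
        ring
    _ = _ := by
        rw [integral_const_mul, hχint, ← ContinuousLinearMap.adjoint_inner_left,
          ContinuousLinearMap.adjoint_inner_right, real_inner_comm]
        rfl

theorem map_inner_sub_identity (hy : IsFrozenFlow P W φ ε y Y) (hW : IsWienerSheet P W)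
    (hε : 0 < ε) (t : unitInterval) (f : L2Gauss) :
    P.map (fun ω => ⟪f, Y ω t - identity⟫) =
      gaussianReal 0 (ε.toNNReal * ‖(√(t : ℝ) • (convOp φ).adjoint) f‖₊ ^ 2) := by
  rw [Measure.map_congr (hy.inner_sub_identity_ae_eq_wienerIntegral hW t f)]
  have hm := (Lp.aestronglyMeasurable
    (hW.wienerIntegral (slabOp t ((convOp φ).adjoint f)))).aemeasurable
  have h := (gaussianReal_const_mul ⟨hm, hW.map_wienerIntegral _⟩ (√ε)).map_eq
  rw [h, mul_zero]
  congr 1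
  refine NNReal.eq ?_
  rw [NNReal.coe_mul, NNReal.coe_mul, Real.coe_toNNReal _ hε.le, NNReal.coe_pow, NNReal.coe_pow,
    coe_nnnorm, coe_nnnorm, norm_slabOp_sq, smul_apply, norm_smul, mul_pow,
    Real.norm_of_nonneg (Real.sqrt_nonneg _), Real.sq_sqrt t.2.1]
  exact congrArg (· * _) (Real.sq_sqrt hε.le)

end IsFrozenFlow

end FlowLDP

/-! ### Convolution as a Fourier multiplier. -/

namespace FlowLDP

open scoped RealInnerProductSpace

/-- A real Schwartz function as a complex one. -/
noncomputable def complexify (φ : 𝓢(ℝ, ℝ)) : 𝓢(ℝ, ℂ) :=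
  φ.postcompCLM Complex.ofRealCLM

theorem complexify_apply (φ : 𝓢(ℝ, ℝ)) (u : ℝ) : complexify φ u = φ u := rfl

/-- The Fourier multiplier operator on `L²(ℝ; ℂ)` with symbol `𝓕 φ`. -/
noncomputable def fourierConv (φ : 𝓢(ℝ, ℝ)) (g : Lp ℂ 2 (volume : Measure ℝ)) :
    Lp ℂ 2 (volume : Measure ℝ) :=
  𝓕⁻ ((ContinuousLinearMap.mul ℂ ℂ).holderL volume ∞ 2 2 ((𝓕 (complexify φ)).toLp ∞ volume) (𝓕 g))

theorem continuous_fourierConv (φ : 𝓢(ℝ, ℝ)) : Continuous (fourierConv φ) := by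
  have h1 : Continuous fun g : Lp ℂ 2 (volume : Measure ℝ) => 𝓕 g :=
    (Lp.fourierTransformₗᵢ ℝ ℂ).continuous
  have h2 : Continuous fun g : Lp ℂ 2 (volume : Measure ℝ) => 𝓕⁻ g :=
    (Lp.fourierTransformₗᵢ ℝ ℂ).symm.continuous
  exact h2.comp ((ContinuousLinearMap.continuous _).comp h1)

theorem fourier_fourierConv (φ : 𝓢(ℝ, ℝ)) (g : Lp ℂ 2 (volume : Measure ℝ)) :
    (𝓕 (fourierConv φ g) : Lp ℂ 2 (volume : Measure ℝ)) =ᵐ[volume]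
      fun ξ => 𝓕 (complexify φ) ξ * (𝓕 g : Lp ℂ 2 (volume : Measure ℝ)) ξ := by
  rw [fourierConv, FourierTransform.fourier_fourierInv_eq]
  filter_upwards [ContinuousLinearMap.coeFn_holder (r := 2) (ContinuousLinearMap.mul ℂ ℂ)
    ((𝓕 (complexify φ)).toLp ∞ volume) (𝓕 g : Lp ℂ 2 (volume : Measure ℝ)),
    SchwartzMap.coeFn_toLp (𝓕 (complexify φ)) ∞ volume] with ξ h1 h2
  rw [← h2]
  exact h1

theorem fourierConv_toLp (φ : 𝓢(ℝ, ℝ)) (ψ : 𝓢(ℝ, ℂ)) :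
    fourierConv φ (ψ.toLp 2 volume) =
      (SchwartzMap.convolution (ContinuousLinearMap.mul ℂ ℂ) ψ (complexify φ)).toLp 2 volume := by
  have hinj : Function.Injective fun g : Lp ℂ 2 (volume : Measure ℝ) => 𝓕 g :=
    (Lp.fourierTransformₗᵢ ℝ ℂ).injective
  refine hinj ?_
  simp only
  rw [SchwartzMap.toLp_fourier_eq, SchwartzMap.fourier_convolution]
  refine Lp.ext ?_
  filter_upwards [fourier_fourierConv φ (ψ.toLp 2 volume), SchwartzMap.coeFn_toLp (𝓕 ψ) 2 volume,
    SchwartzMap.coeFn_toLp (SchwartzMap.pairing (ContinuousLinearMap.mul ℂ ℂ) (𝓕 ψ)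
      (𝓕 (complexify φ))) 2 volume] with ξ h1 h2 h3
  rw [h1, h3, SchwartzMap.toLp_fourier_eq, h2, SchwartzMap.pairing_apply_apply,
    ContinuousLinearMap.mul_apply', mul_comm]

theorem memLp_complexify_shift (φ : 𝓢(ℝ, ℝ)) (u : ℝ) :
    MemLp (fun p => (φ (u - p) : ℂ)) 2 volume :=
  (memLp_reflected_shift φ u).ofReal

theorem continuous_integral_shift_mul (φ : 𝓢(ℝ, ℝ)) (u : ℝ) :
    Continuous fun g : Lp ℂ 2 (volume : Measure ℝ) => ∫ p, (φ (u - p) : ℂ) * g p := by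
  have h : (fun g : Lp ℂ 2 (volume : Measure ℝ) => ∫ p, (φ (u - p) : ℂ) * g p) =
      fun g => inner ℂ ((memLp_complexify_shift φ u).toLp _) g := by
    ext g
    rw [L2.inner_def]
    refine integral_congr_ae ?_
    filter_upwards [MemLp.coeFn_toLp (memLp_complexify_shift φ u)] with p hp
    rw [hp]
    simp [mul_comm]
  rw [h]
  fun_prop

/-- The Fourier multiplier operator with symbol `𝓕 φ` is the convolution with `φ`. -/
theorem coeFn_fourierConv (φ : 𝓢(ℝ, ℝ)) (g : Lp ℂ 2 (volume : Measure ℝ)) :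
    fourierConv φ g =ᵐ[volume] fun u => ∫ p, (φ (u - p) : ℂ) * g p := by
  obtain ⟨ψ, hψ⟩ : ∃ ψ : ℕ → 𝓢(ℝ, ℂ), Tendsto (fun n => (ψ n).toLp 2 volume) atTop (𝓝 g) := by
    have hg := (SchwartzMap.denseRange_toLpCLM (E := ℝ) (F := ℂ) (p := 2) (μ := volume)
      (by simp)) g
    obtain ⟨x, hx, hxg⟩ := mem_closure_iff_seq_limit.1 hg
    choose ψ hψ using hx
    exact ⟨ψ, hxg.congr fun n => (hψ n).symm⟩
  have h1 := ((continuous_fourierConv φ).tendsto g).comp hψ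
  -- The multiplier side converges only in `L²`, so a subsequence is taken to converge a.e.; the
  -- convolution side converges at every `u`, being an inner product with a shift.
  obtain ⟨ns, hns, hae⟩ := (tendstoInMeasure_of_tendsto_Lp h1).exists_seq_tendsto_ae
  have hall : ∀ᵐ u, ∀ n, fourierConv φ ((ψ n).toLp 2 volume) u =
      ∫ p, (φ (u - p) : ℂ) * (ψ n).toLp 2 volume p := by
    rw [ae_all_iff]
    intro n
    rw [fourierConv_toLp]
    filter_upwards [SchwartzMap.coeFn_toLp (SchwartzMap.convolution
      (ContinuousLinearMap.mul ℂ ℂ) (ψ n) (complexify φ)) 2 volume] with u hu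
    rw [hu, SchwartzMap.convolution_apply, convolution_def]
    refine integral_congr_ae ?_
    filter_upwards [SchwartzMap.coeFn_toLp (ψ n) 2 volume] with p hp
    rw [hp, ContinuousLinearMap.mul_apply', complexify_apply, mul_comm]
  filter_upwards [hae, hall] with u hu1 hu2
  refine tendsto_nhds_unique hu1 ?_
  have h2 := (((continuous_integral_shift_mul φ u).tendsto g).comp hψ).comp hns.tendsto_atTop
  refine h2.congr fun n => ?_
  exact (hu2 (ns n)).symm

/-- A real square-integrable function as a complex one. -/
noncomputable def complexLp (g : Lp ℝ 2 (volume : Measure ℝ)) : Lp ℂ 2 (volume : Measure ℝ) :=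
  ((Lp.memLp g).ofReal (K := ℂ)).toLp _

theorem coeFn_complexLp (g : Lp ℝ 2 (volume : Measure ℝ)) :
    complexLp g =ᵐ[volume] fun p => (g p : ℂ) :=
  MemLp.coeFn_toLp ((Lp.memLp g).ofReal (K := ℂ))

theorem norm_complexLp (g : Lp ℝ 2 (volume : Measure ℝ)) : ‖complexLp g‖ = ‖g‖ := by
  rw [complexLp, Lp.norm_toLp, Lp.norm_def]
  congr 1
  exact eLpNorm_congr_norm_ae (ae_of_all _ fun p => by simp)

theorem fourierConv_complexLp (φ : 𝓢(ℝ, ℝ)) (g : Lp ℝ 2 (volume : Measure ℝ)) :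
    fourierConv φ (complexLp g) =ᵐ[volume] fun u => ((⟪reflectedShift φ u, g⟫ : ℝ) : ℂ) := by
  refine (coeFn_fourierConv φ (complexLp g)).trans (ae_of_all _ fun u => ?_)
  simp only
  rw [inner_reflectedShift, ← integral_complex_ofReal]
  refine integral_congr_ae ?_
  filter_upwards [coeFn_complexLp g] with p hp
  rw [hp]
  push_cast
  rfl

theorem memLp_conv (φ : 𝓢(ℝ, ℝ)) (g : Lp ℝ 2 (volume : Measure ℝ)) :
    MemLp (fun u => ⟪reflectedShift φ u, g⟫) 2 volume := by
  have h := (Lp.memLp (fourierConv φ (complexLp g))).re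
  refine h.ae_eq ?_
  filter_upwards [fourierConv_complexLp φ g] with u hu
  rw [hu]
  simp

theorem integrable_shift_mul_mul (φ : 𝓢(ℝ, ℝ)) (g : Lp ℝ 2 (volume : Measure ℝ)) (ψ : ℝ → ℝ)
    (hψ : Integrable ψ) :
    Integrable (fun z : ℝ × ℝ => φ (z.1 - z.2) * g z.2 * ψ z.1) (volume.prod volume) := by
  have hmeas : AEStronglyMeasurable (fun z : ℝ × ℝ => φ (z.1 - z.2) * g z.2 * ψ z.1)
      (volume.prod volume) := by
    have h1 : Continuous fun z : ℝ × ℝ => φ (z.1 - z.2) := φ.continuous.comp (by fun_prop)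
    exact (h1.aestronglyMeasurable.mul (Lp.aestronglyMeasurable g).comp_snd).mul hψ.1.comp_fst
  have hint (u : ℝ) : Integrable (fun p => φ (u - p) * g p) :=
    (memLp_reflected_shift φ u).integrable_mul (Lp.memLp g)
  rw [integrable_prod_iff hmeas]
  refine ⟨ae_of_all _ fun u => (hint u).mul_const (ψ u), ?_⟩
  refine Integrable.mono' (hψ.norm.const_mul (‖φ.toLp 2 volume‖ * ‖g‖))
    hmeas.norm.integral_prod_right' (ae_of_all _ fun u => ?_)
  rw [Real.norm_of_nonneg (integral_nonneg fun p => norm_nonneg _)]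
  simp only [norm_mul _ (ψ u)]
  rw [integral_mul_const]
  gcongr
  set G : Lp ℝ 2 (volume : Measure ℝ) := (Lp.memLp g).norm.toLp _
  set F : Lp ℝ 2 (volume : Measure ℝ) := (memLp_reflected_shift φ u).norm.toLp _
  have hF : ‖F‖ = ‖φ.toLp 2 volume‖ := by
    rw [← norm_reflectedShift φ u, reflectedShift, Lp.norm_toLp, Lp.norm_toLp, eLpNorm_norm]
  have hG : ‖G‖ = ‖g‖ := by
    rw [Lp.norm_toLp, Lp.norm_def, eLpNorm_norm]
  rw [← hF, ← hG]
  refine le_trans (le_of_eq ?_) (real_inner_le_norm F G)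
  rw [L2.inner_def]
  refine integral_congr_ae ?_
  filter_upwards [MemLp.coeFn_toLp (Lp.memLp g).norm,
    MemLp.coeFn_toLp (memLp_reflected_shift φ u).norm] with p h1 h2
  rw [h1, h2]
  simp [mul_comm]

/-- The derivative falls on `φ`, by Fubini and integration by parts. With `memLp_conv` for `φ` and
for its derivative, this places every convolution in the Sobolev space defining `rateDomain`. -/
theorem isWeakDeriv_conv (φ : 𝓢(ℝ, ℝ)) (g : Lp ℝ 2 (volume : Measure ℝ)) :
    IsWeakDeriv (fun u => ⟪reflectedShift φ u, g⟫)
      (fun u => ⟪reflectedShift (SchwartzMap.derivCLM ℝ ℝ φ) u, g⟫) := by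
  intro ψ hψ hψc
  have hψd : Continuous (deriv ψ) := hψ.continuous_deriv (by simp)
  have hi : Integrable ψ := hψ.continuous.integrable_of_hasCompactSupport hψc
  have hi' : Integrable (deriv ψ) := hψd.integrable_of_hasCompactSupport hψc.deriv
  simp_rw [inner_reflectedShift, ← integral_mul_const]
  have hs (χ : 𝓢(ℝ, ℝ)) (η : ℝ → ℝ) (hη : Integrable η) :
      ∫ u, ∫ p, χ (u - p) * g p * η u = ∫ p, ∫ u, χ (u - p) * g p * η u :=
    integral_integral_swap (f := fun u p => χ (u - p) * g p * η u)
      (integrable_shift_mul_mul χ g η hη)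
  rw [hs φ _ hi', hs _ _ hi, ← integral_neg]
  refine integral_congr_ae (ae_of_all _ fun p => ?_)
  have hφp : Continuous fun u => φ (u - p) := φ.continuous.comp (by fun_prop)
  have hφp' : Continuous fun u => SchwartzMap.derivCLM ℝ ℝ φ (u - p) :=
    (SchwartzMap.derivCLM ℝ ℝ φ).continuous.comp (by fun_prop)
  have hparts : ∫ u, φ (u - p) * deriv ψ u =
      -∫ u, SchwartzMap.derivCLM ℝ ℝ φ (u - p) * ψ u := by
    refine integral_mul_deriv_eq_deriv_mul_of_integrable (fun u _ => ?_) (fun u _ => ?_) ?_ ?_ ?_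
    · exact (φ.differentiableAt.hasDerivAt).comp_sub_const u p
    · exact (hψ.differentiable (by simp) u).hasDerivAt
    · exact (hφp.mul hψd).integrable_of_hasCompactSupport hψc.deriv.mul_left
    · exact (hφp'.mul hψ.continuous).integrable_of_hasCompactSupport hψc.mul_left
    · exact (hφp.mul hψ.continuous).integrable_of_hasCompactSupport hψc.mul_left
  have e1 : ∀ u, φ (u - p) * g p * deriv ψ u = g p * (φ (u - p) * deriv ψ u) := fun u => by ring
  have e2 : ∀ u, SchwartzMap.derivCLM ℝ ℝ φ (u - p) * g p * ψ u =
      g p * (SchwartzMap.derivCLM ℝ ℝ φ (u - p) * ψ u) := fun u => by ring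
  simp only [e1, e2, integral_const_mul, hparts]
  ring

end FlowLDP

/-! ### Identification of the rate function. -/

namespace FlowLDP

open scoped RealInnerProductSpace

theorem lintegral_comp_div_pos (f : ℝ → ℝ≥0∞) (c : ℝ) (hc : 0 < c) :
    ∫⁻ ξ, f (ξ / c) = ENNReal.ofReal c * ∫⁻ ξ, f ξ := by
  have hemb : MeasurableEmbedding fun ξ : ℝ => c⁻¹ * ξ :=
    (Homeomorph.mulLeft₀ c⁻¹ (inv_ne_zero hc.ne')).measurableEmbedding
  have h := hemb.lintegral_map (μ := volume) f
  rw [Real.map_volume_mul_left (inv_ne_zero hc.ne'), inv_inv, abs_of_pos hc,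
    lintegral_smul_measure] at h
  simp_rw [div_eq_inv_mul]
  exact h.symm

theorem schwartzFourier_eq (φ : 𝓢(ℝ, ℝ)) (ξ : ℝ) :
    schwartzFourier φ ξ = 𝓕 (complexify φ) (ξ / (2 * Real.pi)) := by
  rw [SchwartzMap.fourier_coe]
  rfl

theorem ae_fourier_complexify_ne_zero (φ : 𝓢(ℝ, ℝ))
    (hφ : ∀ᵐ ξ : ℝ, schwartzFourier φ ξ ≠ 0) : ∀ᵐ ξ : ℝ, 𝓕 (complexify φ) ξ ≠ 0 := by
  have hq : Measure.QuasiMeasurePreserving (fun ξ : ℝ => 2 * Real.pi * ξ) volume volume := by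
    refine ⟨by fun_prop, ?_⟩
    rw [Real.map_volume_mul_left (by positivity)]
    exact Measure.smul_absolutelyContinuous
  filter_upwards [hq.ae hφ] with ξ hξ
  rwa [schwartzFourier_eq, mul_div_cancel_left₀ _ (by positivity)] at hξ

theorem lintegral_rate_eq (φ : 𝓢(ℝ, ℝ)) (c : ℝ → ℝ) (hc : MemLp c 2 volume) :
    ∫⁻ ξ : ℝ, ‖l2Fourier c hc ξ / schwartzFourier φ ξ‖ₑ ^ 2 =
      ENNReal.ofReal (2 * Real.pi) * ∫⁻ ξ : ℝ,
        ‖(𝓕 (hc.ofReal (K := ℂ)).toLp : Lp ℂ 2 (volume : Measure ℝ)) ξ /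
          𝓕 (complexify φ) ξ‖ₑ ^ 2 := by
  rw [← lintegral_comp_div_pos _ _ (by positivity)]
  simp_rw [schwartzFourier_eq]
  rfl

theorem lintegral_enorm_sq_eq {f : ℝ → ℂ} (hf : MemLp f 2 volume) :
    ∫⁻ ξ, ‖f ξ‖ₑ ^ 2 = ENNReal.ofReal (‖hf.toLp f‖ ^ 2) := by
  rw [ENNReal.ofReal_pow (norm_nonneg _), Lp.norm_toLp, ENNReal.ofReal_toReal hf.2.ne]
  have h := eLpNorm_nnreal_pow_eq_lintegral (f := f) (μ := volume) (p := 2) (by norm_num)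
  simpa using h.symm

/-- The Fourier expression of the rate of a convolution. -/
theorem lintegral_rate_of_ae_eq (φ : 𝓢(ℝ, ℝ)) (hφ : ∀ᵐ ξ : ℝ, schwartzFourier φ ξ ≠ 0)
    (g : Lp ℝ 2 (volume : Measure ℝ)) (c : ℝ → ℝ) (hc : MemLp c 2 volume)
    (hcg : c =ᵐ[volume] fun u => ⟪reflectedShift φ u, g⟫) :
    ∫⁻ ξ : ℝ, ‖l2Fourier c hc ξ / schwartzFourier φ ξ‖ₑ ^ 2 =
      ENNReal.ofReal (2 * Real.pi * ‖g‖ ^ 2) := by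
  have h1 : (hc.ofReal (K := ℂ)).toLp = fourierConv φ (complexLp g) := by
    refine Lp.ext ?_
    filter_upwards [MemLp.coeFn_toLp (hc.ofReal (K := ℂ)), hcg, fourierConv_complexLp φ g]
      with u h1 h2 h3
    rw [h1, h2, h3]
    rfl
  rw [lintegral_rate_eq, h1, ENNReal.ofReal_mul (p := 2 * Real.pi) (by positivity)]
  congr 1
  have h2 : ∫⁻ ξ : ℝ, ‖(𝓕 (fourierConv φ (complexLp g)) : Lp ℂ 2 (volume : Measure ℝ)) ξ /
      𝓕 (complexify φ) ξ‖ₑ ^ 2 =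
      ∫⁻ ξ : ℝ, ‖(𝓕 (complexLp g) : Lp ℂ 2 (volume : Measure ℝ)) ξ‖ₑ ^ 2 := by
    refine lintegral_congr_ae ?_
    filter_upwards [fourier_fourierConv φ (complexLp g), ae_fourier_complexify_ne_zero φ hφ]
      with ξ h3 h4
    rw [h3, mul_div_cancel_left₀ _ h4]
  rw [h2, lintegral_enorm_sq_eq (Lp.memLp _), Lp.toLp_coeFn, Lp.norm_fourier_eq, norm_complexLp]

/-- A function with finite rate is a convolution with `φ`. -/
theorem exists_ae_eq_conv_of_lintegral_rate_ne_top (φ : 𝓢(ℝ, ℝ))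
    (hφ : ∀ᵐ ξ : ℝ, schwartzFourier φ ξ ≠ 0) (c : ℝ → ℝ) (hc : MemLp c 2 volume)
    (hfin : ∫⁻ ξ : ℝ, ‖l2Fourier c hc ξ / schwartzFourier φ ξ‖ₑ ^ 2 ≠ ∞) :
    ∃ g : Lp ℝ 2 (volume : Measure ℝ), c =ᵐ[volume] fun u => ⟪reflectedShift φ u, g⟫ := by
  rw [lintegral_rate_eq] at hfin
  have hpi : ENNReal.ofReal (2 * Real.pi) ≠ 0 := by
    rw [Ne, ENNReal.ofReal_eq_zero, not_le]; positivity
  set C : Lp ℂ 2 (volume : Measure ℝ) := (hc.ofReal (K := ℂ)).toLp with hC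
  set Q : ℝ → ℂ := fun ξ => (𝓕 C : Lp ℂ 2 (volume : Measure ℝ)) ξ / 𝓕 (complexify φ) ξ with hQ
  have hQm : MemLp Q 2 volume := by
    refine ⟨?_, ?_⟩
    · exact ((Lp.aestronglyMeasurable _).aemeasurable.div
        (𝓕 (complexify φ)).continuous.measurable.aemeasurable).aestronglyMeasurable
    · have h := eLpNorm_nnreal_pow_eq_lintegral (f := Q) (μ := volume) (p := 2) (by norm_num)
      have h2 : ∫⁻ ξ, ‖Q ξ‖ₑ ^ 2 ≠ ∞ := fun h3 => hfin (by rw [h3, ENNReal.mul_top hpi])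
      by_contra hcon
      rw [not_lt, top_le_iff] at hcon
      rw [show ((2 : ℝ≥0) : ℝ≥0∞) = 2 by simp, hcon] at h
      simp at h
      exact h2 h.symm
  set gC : Lp ℂ 2 (volume : Measure ℝ) := 𝓕⁻ (hQm.toLp Q) with hgC
  have hconv : fourierConv φ gC = C := by
    refine (Lp.fourierTransformₗᵢ ℝ ℂ).injective (Lp.ext ?_)
    filter_upwards [fourier_fourierConv φ gC, ae_fourier_complexify_ne_zero φ hφ,
      MemLp.coeFn_toLp hQm] with ξ h1 h2 h3
    refine h1.trans ?_
    rw [hgC, FourierTransform.fourier_fourierInv_eq, h3, hQ]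
    exact mul_div_cancel₀ _ h2
  -- Since `φ` and `c` are real, the real part of the complex solution solves the same convolution
  -- equation.
  refine ⟨(Lp.memLp gC).re.toLp _, ?_⟩
  filter_upwards [coeFn_fourierConv φ gC, MemLp.coeFn_toLp (hc.ofReal (K := ℂ))] with u h1 h2
  rw [hconv, hC, h2] at h1
  rw [inner_reflectedShift]
  have hint : Integrable (fun p => (φ (u - p) : ℂ) * gC p) :=
    (memLp_complexify_shift φ u).integrable_mul (Lp.memLp gC)
  have h3 := integral_re hint
  rw [← h1] at h3
  refine Eq.trans (b := ∫ p, RCLike.re ((φ (u - p) : ℂ) * gC p)) ?_ (integral_congr_ae ?_)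
  · simpa using h3.symm
  · filter_upwards [MemLp.coeFn_toLp (Lp.memLp gC).re] with p hp
    rw [hp]
    simp

/-- The Gaussian and Lebesgue measures have the same null sets, so an identity in `L₂(ℝ, μ)` can be
read Lebesgue-a.e. -/
theorem eq_identity_add_convOp_iff (φ : 𝓢(ℝ, ℝ)) (g : Lp ℝ 2 (volume : Measure ℝ))
    (h : L2Gauss) :
    identity + convOp φ g = h ↔ centred h =ᵐ[volume] fun u => ⟪reflectedShift φ u, g⟫ := by
  have hac := gaussianReal_absolutelyContinuous 0 (one_ne_zero (α := ℝ≥0))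
  have hac' := gaussianReal_absolutelyContinuous' 0 (one_ne_zero (α := ℝ≥0))
  constructor
  · rintro rfl
    refine hac'.ae_le ?_
    filter_upwards [Lp.coeFn_add identity (convOp φ g), coeFn_identity, coeFn_convOp φ g]
      with u h1 h2 h3
    rw [centred, h1, Pi.add_apply, h2, h3, add_sub_cancel_left]
  · intro hc
    refine Lp.ext ?_
    filter_upwards [Lp.coeFn_add identity (convOp φ g), coeFn_identity, coeFn_convOp φ g,
      hac.ae_le hc] with u h1 h2 h3 h4
    rw [h1, Pi.add_apply, h2, h3, ← h4, centred]
    ring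

/-- With `h - e = φ * g`, the rate is `(4πt)⁻¹ · 2π ‖g‖² = ‖g‖²/(2t)`, and `g = √t g'` turns this
into `‖g'‖²/2`. -/
theorem marginalRate_le_iff (φ : 𝓢(ℝ, ℝ)) (hφ : ∀ᵐ ξ : ℝ, schwartzFourier φ ξ ≠ 0)
    (t : unitInterval) (h : L2Gauss) (a : ℝ≥0) :
    marginalRate φ t h ≤ a ↔ ∃ g, ‖g‖ ^ 2 ≤ 2 * a ∧
      identity + (√(t : ℝ) • (convOp φ).adjoint).adjoint g = h := by
  have ht0 : (0 : ℝ) ≤ t := t.2.1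
  have hpi := Real.pi_pos
  have hadj (g : Lp ℝ 2 (volume : Measure ℝ)) :
      (√(t : ℝ) • (convOp φ).adjoint).adjoint g = convOp φ (√(t : ℝ) • g) := by
    rw [map_smulₛₗ, ContinuousLinearMap.adjoint_adjoint, map_smul]
    rfl
  -- Valid also for `t = 0`: as `a` is finite, `∞ * N ≤ a` holds exactly when `N = 0`.
  have hdiv (N : ℝ≥0∞) : (ENNReal.ofReal (4 * Real.pi * t))⁻¹ * N ≤ a ↔
      N ≤ ENNReal.ofReal (4 * Real.pi * t * a) := by
    rw [mul_comm, ← div_eq_mul_inv, ENNReal.div_le_iff_le_mul (.inr ENNReal.coe_ne_top)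
      (.inl ENNReal.ofReal_ne_top), mul_comm, ENNReal.ofReal_mul (q := (a : ℝ)) (by positivity),
      ENNReal.ofReal_coe_nnreal, mul_comm]
  simp_rw [hadj, eq_identity_add_convOp_iff]
  constructor
  · intro hle
    by_cases hh : h ∈ rateDomain
    swap
    · simp [marginalRate, hh] at hle
    rw [marginalRate, dif_pos hh, hdiv] at hle
    obtain ⟨g, hg⟩ := exists_ae_eq_conv_of_lintegral_rate_ne_top φ hφ _ hh.1
      (hle.trans_lt ENNReal.ofReal_lt_top).ne
    rw [lintegral_rate_of_ae_eq φ hφ g _ hh.1 hg, ENNReal.ofReal_le_ofReal_iff (by positivity)] at hle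
    have hle' : ‖g‖ ^ 2 ≤ 2 * a * t := by
      have : 2 * Real.pi * ‖g‖ ^ 2 ≤ 2 * Real.pi * (2 * a * t) := by linarith
      exact le_of_mul_le_mul_left this (by positivity)
    rcases ht0.eq_or_lt with ht | ht
    · rw [← ht, mul_zero] at hle'
      have hg0 : g = 0 := by
        rw [← norm_eq_zero]
        exact pow_eq_zero_iff (two_ne_zero) |>.1 (le_antisymm hle' (by positivity))
      exact ⟨0, by simp, by simpa [hg0] using hg⟩
    · refine ⟨(√(t : ℝ))⁻¹ • g, ?_, ?_⟩
      · rw [norm_smul, mul_pow, norm_inv, Real.norm_of_nonneg (Real.sqrt_nonneg _), inv_pow,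
          Real.sq_sqrt ht0, inv_mul_le_iff₀ ht]
        linarith
      · rwa [smul_inv_smul₀ (Real.sqrt_pos.2 ht).ne']
  · rintro ⟨g, hg, hgh⟩
    set g' := √(t : ℝ) • g
    have hmem : h ∈ rateDomain := by
      refine ⟨(memLp_conv φ g').ae_eq hgh.symm, _,
        memLp_conv (SchwartzMap.derivCLM ℝ ℝ φ) g', fun ψ hψ hψc => ?_⟩
      rw [← isWeakDeriv_conv φ g' ψ hψ hψc]
      refine integral_congr_ae ?_
      filter_upwards [hgh] with u hu
      rw [hu]
    rw [marginalRate, dif_pos hmem, hdiv, lintegral_rate_of_ae_eq φ hφ g' _ hmem.1 hgh]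
    refine ENNReal.ofReal_le_ofReal ?_
    rw [norm_smul, mul_pow, Real.norm_of_nonneg (Real.sqrt_nonneg _), Real.sq_sqrt ht0]
    have : t * ‖g‖ ^ 2 ≤ t * (2 * a) := by gcongr
    nlinarith

end FlowLDP

theorem corollary2p1 {Ω : Type*} [MeasurableSpace Ω] (P : Measure Ω) [IsProbabilityMeasure P]
    (W : Set (ℝ × ℝ) → Ω → ℝ) (hW : FlowLDP.IsWienerSheet P W)
    (φ : 𝓢(ℝ, ℝ)) (hφ : ∀ᵐ ξ : ℝ, FlowLDP.schwartzFourier φ ξ ≠ 0)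
    (y : ℝ → ℝ → unitInterval → Ω → ℝ) (Y : ℝ → Ω → C(unitInterval, FlowLDP.L2Gauss))
    (hy : ∀ ε : ℝ, 0 < ε → FlowLDP.IsFrozenFlow P W φ ε (y ε) (Y ε))
    (t : unitInterval) :
    FlowLDP.SatisfiesLDP P (fun ε ω => Y ε ω t) (FlowLDP.marginalRate φ t) := by
  borelize FlowLDP.L2Gauss
  have : Fact ((2 : ℝ≥0∞) ≠ ∞) := ⟨by simp⟩
  refine satisfiesLDP_of_map_inner_eq_gaussianReal P
    (√(t : ℝ) • (FlowLDP.convOp φ).adjoint) FlowLDP.identity _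
    (FlowLDP.marginalRate_le_iff φ hφ t) _ (fun ε hε => ?_)
    fun ε hε f => (hy ε hε).map_inner_sub_identity hW hε t f
  exact ((continuous_eval_const t).comp_aestronglyMeasurable (hy ε hε).random_element).aemeasurable
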